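/- Let $K$ be a field of characteristic $p>0$ and let $f,g\in K[z]$ be polynomials of degrees $n$ and $m$ (the degree of the zero polynomial being counted as $0$ here) such that $p\nmid\gcd(n,m)$. (1) Suppose $n>0$. Let $L=K[f,f^{-1},g]$, with $f$ and $g$ regarded as independent variables, and let $\deg h$ denote the $z$-degree (degree of the numerator minus degree of the denominator) of the image of $h\in L$ in $K(z)$ under $f\mapsto f(z)$, $g\mapsto g(z)$. Define elements $g_0,g_1,\dots$ of $L$ as follows. Put $g_0=g$. If $g_0,\dots,g_s$ are constructed and $g_s$ is non-zero in $K(z)$, put $m_i=\deg g_i$, $d_{-1}=n$, $d_i=\gcd(n,m_0,\dots,m_i)$, $a_i=d_{i-1}/d_i$ for $0\le i\le s$, and call $f^{i}g_0^{j_0}\cdots g_k^{j_k}$ with $i\in\mathbb Z$ and $0\le j_l<a_l$ a $k$-standard monomial (a $(-1)$-standard monomial is a power $f^i$). Subtract from $g_s^{a_s}$ a $K$-multiple of an $(s-1)$-standard monomial of the same $z$-degree so that the result has smaller $z$-degree or is zero in $K(z)$; then, as long as the current expression is non-zero in $K(z)$ and has $z$-degree divisible by $d_s$, lower its $z$-degree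 (or make it zero in $K(z)$) in the same way by subtracting a $K$-multiple of an $s$-standard monomial of the same $z$-degree. The expression at which this ends is $g_{s+1}$. The algorithm ends when some $g_s$ is zero in $K(z)$. Then the algorithm can be carried out and ends after finitely many steps with an element that is zero in $K(z)$, and all $g_i$ which it produces (including this last one) are polynomials in $f$ and $g$, i.e. they lie in the subring $K[f,g]$ of $L$. (2) (The Abhyankar-Moh-Suzuki conclusion.) If $K[f,g]=K[z]$, then $n$ divides $m$ or $m$ divides $n$. -/

import Mathlib

open Polynomial

namespace AMS

/-- The ring `L = K[f, f⁻¹, g]` in two variables `f`, `g`: polynomials in `g` whose coefficients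
are Laurent polynomials in `f`. -/
abbrev LRing (K : Type*) [Field K] : Type _ := Polynomial (LaurentPolynomial K)

/-- The variable `f` of `L`. -/
noncomputable def varF (K : Type*) [Field K] : LRing K := C (LaurentPolynomial.T 1)

/-- The variable `g` of `L`. -/
noncomputable def varG (K : Type*) [Field K] : LRing K := X

section Algorithm

variable {K : Type*} [Field K] (f g : K[X]) (hf : f ≠ 0)

/-- The homomorphism `L → K(z)` which substitutes `f(z)` and `g(z)` for the two variables. -/
noncomputable def toRat : LRing K →+* RatFunc K :=
  Polynomial.eval₂RingHom
    (LaurentPolynomial.eval₂ (RatFunc.C : K →+* RatFunc K)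
      (Units.mk0 (algebraMap K[X] (RatFunc K) f) (RatFunc.algebraMap_ne_zero hf)))
    (algebraMap K[X] (RatFunc K) g)

/-- The `z`-degree of an element of `L` (degree of the numerator minus degree of the denominator
of its image in `K(z)`); used only for elements with non-zero image. -/
noncomputable def zdeg (h : LRing K) : ℤ := (toRat f g hf h).intDegree

/-- `gcdSeq k = gcd (n, m₀, …, m_{k-1})`, where `n = deg f` and `m_i = deg g_i`.
With the usual numbering `d_{-1} = n`, `d_i = (n, m₀, …, m_i)` this is `d_{k-1}`. -/
noncomputable def gcdSeq (G : ℕ → LRing K) : ℕ → ℕ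
  | 0 => f.natDegree
  | k + 1 => Nat.gcd (gcdSeq G k) (zdeg f g hf (G k)).natAbs

/-- `a_k = d_{k-1} / d_k`. -/
noncomputable def ratioSeq (G : ℕ → LRing K) (k : ℕ) : ℕ :=
  gcdSeq f g hf G k / gcdSeq f g hf G (k + 1)

/-- `m` is a standard monomial in `f, g₀, …, g_{t-1}`, that is, a `(t-1)`-standard monomial
`f^i g₀^{j₀} ⋯ g_{t-1}^{j_{t-1}}` with `i ∈ ℤ` and `0 ≤ j_k < a_k`. -/
def IsStandard (G : ℕ → LRing K) (t : ℕ) (m : LRing K) : Prop :=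
  ∃ (i : ℤ) (j : ℕ → ℕ), (∀ k < t, j k < ratioSeq f g hf G k) ∧
    m = C (LaurentPolynomial.T i) * ∏ k ∈ Finset.range t, G k ^ j k

/-- One reduction of the degree: from `h`, which is non-zero in `K(z)`, subtract `c • m`, where `m`
is the `(t-1)`-standard monomial with `deg m = deg h` and `c ∈ K` is such that the result has
smaller degree or is zero in `K(z)`. -/
def Reduces (G : ℕ → LRing K) (t : ℕ) (h h' : LRing K) : Prop :=
  toRat f g hf h ≠ 0 ∧
    ∃ (m : LRing K) (c : K), IsStandard f g hf G t m ∧ zdeg f g hf m = zdeg f g hf h ∧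
      h' = h - c • m ∧ (toRat f g hf h' = 0 ∨ zdeg f g hf h' < zdeg f g hf h)

/-- The step of the algorithm that produces `g_{s+1}` from `g₀, …, g_s`: reduce `g_s ^ a_s` by an
`(s-1)`-standard monomial, then reduce by `s`-standard monomials, until the result is zero
in `K(z)` or has degree not divisible by `d_s`. -/
def IsStep (G : ℕ → LRing K) (s : ℕ) : Prop :=
  ∃ h : LRing K, Reduces f g hf G s (G s ^ ratioSeq f g hf G s) h ∧
    Relation.ReflTransGen (Reduces f g hf G (s + 1)) h (G (s + 1)) ∧
    (toRat f g hf (G (s + 1)) = 0 ∨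
      ¬ (gcdSeq f g hf G (s + 1) : ℤ) ∣ zdeg f g hf (G (s + 1)))

/-- `g₀, …, g_s` are the elements produced by the first `s` steps of the algorithm (a step is
made only from a `g_i` that is non-zero in `K(z)`). The values of `G` beyond `s` are irrelevant. -/
def IsRun (G : ℕ → LRing K) (s : ℕ) : Prop :=
  G 0 = varG K ∧ ∀ i < s, toRat f g hf (G i) ≠ 0 ∧ IsStep f g hf G i

end Algorithm

end AMS

/-! Write D_s = a_0 ⋯ a_{s-1} (`dimSeq`), so that D_s d_{s-1} = n. The exponents of a standard
monomial act like digits in a mixed radix: every multiple of d_{s-1} is the z-degree of exactly one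
(s-1)-standard monomial. Since g_s is monic of degree D_s in g, repeated division shows that these
monomials span the elements of L of g-degree below D_s. Hence a non-zero element of g-degree below
D_s has non-zero image in K(z), and its z-degree is divisible by d_{s-1} (`Regular.exists_vdeg`).

Termination. Either the minimal monic relation between f(z) and g(z) has g-degree D_{s+1}, and the
reductions can be steered to it; or a dimension count bounds the degrees from below
(`Regular.exists_lower_bound`). For s > 0 a non-zero g_s has degree not divisible by d_{s-1}, so d_s
< d_{s-1} and there are finitely many steps. The last element g_r is the minimal relation itself,
which has coefficients in K[f].

Polynomiality is pulled back from g_r to each g_s with 0 < s < r. The number e = D_r / D_s divides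
gcd(n, m), so it is invertible in K. Completing e-th powers changes g_s into an approximate e-th
root H of g_r, whose coefficients are obtained from those of g_r by ring operations and division by
e, so they lie in K[f] (`approximateRoot_coeff_mem`). A filtration by powers of H shows that g_s - H
has z-degree below m_s (`IsRun.exists_approximateRoot`). By induction, g_{s-1}^{a_{s-1}} - H is a
combination of standard monomials without negative powers of f; its part of degree above m_s is
g_{s-1}^{a_{s-1}} - g_s, so g_s is polynomial too (`IsRun.coeffIn`).

If K[f, g] = K[z] and d = gcd(n, m), then z^d has the degree of a standard monomial with
non-negative powers of f. By uniqueness this monomial is some f^i g^j, so i n + j m = d with i, j ≥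
0, which forces m ∣ n or n ∣ m. -/

namespace AMS

/-! ### Approximate roots -/

section PolynomialLemmas

/-- The difference of the `e`-th powers of two monic polynomials `P`, `Q` of degree `d`: its
coefficient at `(e-1) d + j` when `P - Q` has degree at most `j`. -/
theorem coeff_pow_sub_pow {A : Type*} [CommRing A] {P Q : A[X]} {d e j : ℕ}
    (hP : P.Monic) (hPd : P.natDegree = d) (hQ : Q.Monic) (hQd : Q.natDegree = d)
    (hj : (P - Q).natDegree ≤ j) :
    (P ^ e - Q ^ e).natDegree ≤ (e - 1) * d + j ∧
      (P ^ e - Q ^ e).coeff ((e - 1) * d + j) = e * (P - Q).coeff j := by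
  have key : ∀ k ∈ Finset.range e, (P ^ k * Q ^ (e - 1 - k)).natDegree ≤ (e - 1) * d ∧
      (P ^ k * Q ^ (e - 1 - k)).coeff ((e - 1) * d) = 1 := by
    intro k hk
    have hk' : k + (e - 1 - k) = e - 1 := by have := Finset.mem_range.1 hk; omega
    have hm : (P ^ k * Q ^ (e - 1 - k)).Monic := (hP.pow k).mul (hQ.pow _)
    have hd : (P ^ k * Q ^ (e - 1 - k)).natDegree = (e - 1) * d := by
      rw [(hP.pow k).natDegree_mul (hQ.pow _), hP.natDegree_pow, hQ.natDegree_pow, hPd, hQd,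
        ← add_mul, hk']
    exact ⟨hd.le, by rw [← hd]; exact hm⟩
  have hS : (∑ k ∈ Finset.range e, P ^ k * Q ^ (e - 1 - k)).natDegree ≤ (e - 1) * d :=
    natDegree_sum_le_of_forall_le _ _ fun k hk => (key k hk).1
  have hSc : (∑ k ∈ Finset.range e, P ^ k * Q ^ (e - 1 - k)).coeff ((e - 1) * d) = e := by
    rw [finsetSum_coeff, Finset.sum_congr rfl fun k hk => (key k hk).2]
    simp
  rw [← (Commute.all P Q).geom_sum₂_mul e]
  exact ⟨natDegree_mul_le.trans (add_le_add hS hj), by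
    rw [coeff_mul_add_eq_of_natDegree_le hS hj, hSc]⟩

/-- An approximate `e`-th root of a polynomial with coefficients in a subring `B` in which `e` is
invertible has coefficients in `B`. -/
theorem approximateRoot_coeff_mem {A : Type*} [CommRing A] [Nontrivial A] (B : Subring A)
    {Q H : A[X]} {d e : ℕ} (hH : H.Monic) (hHd : H.natDegree = d) (hQ : ∀ k, Q.coeff k ∈ B)
    (hQH : ∀ k, (e - 1) * d ≤ k → (Q - H ^ e).coeff k = 0)
    (hB : ∀ x : A, (e : A) * x ∈ B → x ∈ B) (k : ℕ) : H.coeff k ∈ B := by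
  have hpow : ∀ {P : A[X]}, (∀ k, P.coeff k ∈ B) → ∀ k, (P ^ e).coeff k ∈ B := by
    intro P hP k
    have h1 : P ∈ liftsRing B.subtype := by
      rw [← lifts_iff_liftsRing, lifts_iff_coeff_lifts]
      exact fun n => ⟨⟨_, hP n⟩, rfl⟩
    have h2 := (liftsRing B.subtype).pow_mem h1 e
    rw [← lifts_iff_liftsRing, lifts_iff_coeff_lifts] at h2
    obtain ⟨y, hy⟩ := h2 k
    rw [← hy]
    exact y.2
  -- Coefficients are recovered from the top downwards; `j` counts how many below degree `d` are
  -- already known to lie in `B`.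
  have main : ∀ j, ∀ i, d ≤ i + j → H.coeff i ∈ B := by
    intro j
    induction j with
    | zero =>
      intro i hi
      rcases (show d = i ∨ d < i by omega) with h | h
      · rw [← h, ← hHd, hH.coeff_natDegree]
        exact B.one_mem
      · rw [coeff_eq_zero_of_natDegree_lt (by omega)]
        exact B.zero_mem
    | succ j ih =>
      intro i hi
      by_cases hij : d ≤ i + j
      · exact ih i hij
      -- `H₁` is the known part of `H`. At (e-1)d + i the coefficient of `H ^ e` exceeds that of `H₁
      -- ^ e` by exactly e times the unknown coefficient.
      set H₁ : A[X] := ∑ l ∈ Finset.Ioc i d, monomial l (H.coeff l) with hH₁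
      have hc : ∀ l, H₁.coeff l = if i < l then H.coeff l else 0 := by
        intro l
        rw [hH₁, finsetSum_coeff]
        simp only [coeff_monomial]
        rw [Finset.sum_ite_eq']
        simp only [Finset.mem_Ioc]
        by_cases h1 : i < l
        · by_cases h2 : l ≤ d
          · simp [h1, h2]
          · simp [h1, h2, coeff_eq_zero_of_natDegree_lt (show H.natDegree < l by omega)]
        · simp [h1]
      have hd1 : H₁.natDegree ≤ d := by
        rw [natDegree_le_iff_coeff_eq_zero]
        intro l hl
        rw [hc, coeff_eq_zero_of_natDegree_lt (by omega)]
        simp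
      have hc1 : H₁.coeff d = 1 := by
        rw [hc, if_pos (by omega), ← hHd]
        exact hH
      have hm1 : H₁.Monic := monic_of_natDegree_le_of_coeff_eq_one d hd1 hc1
      have hdeg : (H - H₁).natDegree ≤ i := by
        rw [natDegree_le_iff_coeff_eq_zero]
        intro l hl
        rw [coeff_sub, hc, if_pos hl, sub_self]
      have hd1' : H₁.natDegree = d :=
        natDegree_eq_of_le_of_coeff_ne_zero hd1 (by rw [hc1]; exact one_ne_zero)
      have h := (coeff_pow_sub_pow (e := e) hH hHd hm1 hd1' hdeg).2
      have hQ0 := hQH ((e - 1) * d + i) (by omega)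
      rw [coeff_sub, sub_eq_zero] at hQ0
      rw [coeff_sub, ← hQ0, coeff_sub, hc, if_neg (lt_irrefl i), sub_zero] at h
      apply hB
      rw [← h]
      refine B.sub_mem (hQ _) (hpow (fun l => ?_) _)
      rw [hc]
      split_ifs with hl
      · exact ih l (by omega)
      · exact B.zero_mem
  exact main d k (by omega)

/-! ### Standard monomials and expansions in powers of the g_k -/

variable {K : Type*} [Field K]

/-- The standard monomials `f^i g₀^{j₀} ⋯ g_{t-1}^{j_{t-1}}` with `i ∈ I` and `j_k < a_k`. -/
def Std (I : Set ℤ) (G : ℕ → LRing K) (a : ℕ → ℕ) : ℕ → Set (LRing K)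
  | 0 => {M | ∃ i ∈ I, M = C (LaurentPolynomial.T i)}
  | t + 1 => {M | ∃ M' ∈ Std I G a t, ∃ j < a t, M = M' * G t ^ j}

variable {I : Set ℤ} {G : ℕ → LRing K} {a : ℕ → ℕ}

theorem Std_mono {J : Set ℤ} (hIJ : I ⊆ J) : ∀ t, Std I G a t ⊆ Std J G a t
  | 0 => by
    rintro _ ⟨i, hi, rfl⟩
    exact ⟨i, hIJ hi, rfl⟩
  | t + 1 => by
    rintro _ ⟨M, hM, j, hj, rfl⟩
    exact ⟨M, Std_mono hIJ t hM, j, hj, rfl⟩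

theorem Std_subset_succ {t : ℕ} (ha : 0 < a t) : Std I G a t ⊆ Std I G a (t + 1) :=
  fun M hM => ⟨M, hM, 0, ha, by simp⟩

theorem Std_subset_of_le {s t : ℕ} (hst : s ≤ t) (ha : ∀ k < t, 0 < a k) :
    Std I G a s ⊆ Std I G a t := by
  induction t, hst using Nat.le_induction with
  | base => exact subset_rfl
  | succ t hst ih =>
    exact (ih fun k hk => ha k (by omega)).trans (Std_subset_succ (ha t (by omega)))

theorem Std_congr {G' : ℕ → LRing K} {a' : ℕ → ℕ} : ∀ t, (∀ k < t, G k = G' k) →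
    (∀ k < t, a k = a' k) → Std I G a t = Std I G' a' t
  | 0, _, _ => rfl
  | t + 1, h, h' => by
    simp only [Std]
    rw [Std_congr t (fun k hk => h k (by omega)) (fun k hk => h' k (by omega)), h t (by omega),
      h' t (by omega)]

/-- The coefficients of a polynomial lie in the subalgebra `B`. -/
def CoeffIn (B : Subalgebra K (LaurentPolynomial K)) (P : LRing K) : Prop :=
  ∀ k, P.coeff k ∈ B

variable {B : Subalgebra K (LaurentPolynomial K)}

/-- Identifies the condition with membership in a subring, which gives closure under the ring
operations. -/
theorem coeffIn_iff {P : LRing K} :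
    CoeffIn B P ↔ P ∈ liftsRing (algebraMap B (LaurentPolynomial K)) := by
  rw [← lifts_iff_liftsRing, lifts_iff_coeff_lifts]
  refine forall_congr' fun n => ⟨fun h => ⟨⟨_, h⟩, rfl⟩, ?_⟩
  rintro ⟨y, hy⟩
  rw [← hy]
  exact y.2

theorem CoeffIn.mul {P Q : LRing K} (hP : CoeffIn B P) (hQ : CoeffIn B Q) : CoeffIn B (P * Q) :=
  coeffIn_iff.2 (mul_mem (coeffIn_iff.1 hP) (coeffIn_iff.1 hQ))

theorem CoeffIn.add {P Q : LRing K} (hP : CoeffIn B P) (hQ : CoeffIn B Q) : CoeffIn B (P + Q) :=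
  coeffIn_iff.2 (add_mem (coeffIn_iff.1 hP) (coeffIn_iff.1 hQ))

theorem CoeffIn.sub {P Q : LRing K} (hP : CoeffIn B P) (hQ : CoeffIn B Q) : CoeffIn B (P - Q) :=
  coeffIn_iff.2 (sub_mem (coeffIn_iff.1 hP) (coeffIn_iff.1 hQ))

theorem CoeffIn.pow {P : LRing K} (hP : CoeffIn B P) (k : ℕ) : CoeffIn B (P ^ k) :=
  coeffIn_iff.2 (pow_mem (coeffIn_iff.1 hP) k)

theorem CoeffIn.smul {P : LRing K} (hP : CoeffIn B P) (c : K) : CoeffIn B (c • P) := by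
  intro k
  rw [coeff_smul]
  exact B.smul_mem (hP k) c

theorem coeffIn_C {x : LaurentPolynomial K} (hx : x ∈ B) : CoeffIn B (C x) := by
  intro k
  rw [coeff_C]
  split_ifs
  exacts [hx, B.zero_mem]

theorem coeffIn_X : CoeffIn B (X : LRing K) := by
  intro k
  rw [coeff_X]
  split_ifs
  exacts [B.one_mem, B.zero_mem]

theorem coeffIn_top (P : LRing K) : CoeffIn ⊤ P := fun _ => trivial

/-- Division by a monic polynomial can be carried out over `B` itself and commutes with extension of
scalars. -/
theorem CoeffIn.mod_div {P Q : LRing K} (hP : CoeffIn B P) (hQ : CoeffIn B Q) (hm : Q.Monic) :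
    CoeffIn B (P %ₘ Q) ∧ CoeffIn B (P /ₘ Q) := by
  rw [coeffIn_iff, ← lifts_iff_liftsRing] at hP hQ
  obtain ⟨q, hq, -, hqm⟩ := lifts_and_degree_eq_and_monic hQ hm
  obtain ⟨p, hp⟩ := (mem_lifts _).1 hP
  rw [coeffIn_iff, coeffIn_iff, ← lifts_iff_liftsRing, ← lifts_iff_liftsRing, mem_lifts, mem_lifts,
    ← hp, ← hq]
  exact ⟨⟨p %ₘ q, map_modByMonic _ hqm⟩, ⟨p /ₘ q, map_divByMonic _ hqm⟩⟩

theorem coeffIn_of_mem_span {S : Set (LRing K)} (hS : ∀ M ∈ S, CoeffIn B M) {P : LRing K}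
    (hP : P ∈ Submodule.span K S) : CoeffIn B P := by
  induction hP using Submodule.span_induction with
  | mem M hM => exact hS M hM
  | zero => exact coeffIn_iff.2 (zero_mem _)
  | add _ _ _ _ h₁ h₂ => exact h₁.add h₂
  | smul c _ _ h => exact h.smul c

theorem Std_coeffIn (hI : ∀ i ∈ I, LaurentPolynomial.T i ∈ B) :
    ∀ t, (∀ k < t, CoeffIn B (G k)) → ∀ M ∈ Std I G a t, CoeffIn B M
  | 0, _ => by
    rintro _ ⟨i, hi, rfl⟩
    exact coeffIn_C (hI i hi)
  | t + 1, hG => by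
    rintro _ ⟨M, hM, j, hj, rfl⟩
    exact (Std_coeffIn hI t (fun k hk => hG k (by omega)) M hM).mul ((hG t (by omega)).pow j)

/-- The degree of `P * Q ^ j` when `deg P < deg Q` and `j < a`. -/
theorem degree_mul_pow_lt {A : Type*} [CommRing A] [IsDomain A] {P Q : A[X]} {d a j : ℕ}
    (hQ : Q.Monic) (hQd : Q.natDegree = d) (hP : P.degree < d) (hj : j < a) :
    (P * Q ^ j).degree < (a * d : ℕ) := by
  by_cases h0 : P = 0
  · rw [h0, zero_mul, degree_zero]
    exact WithBot.bot_lt_coe _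
  rw [← natDegree_lt_iff_degree_lt h0] at hP
  rw [← natDegree_lt_iff_degree_lt (mul_ne_zero h0 (hQ.pow j).ne_zero),
    natDegree_mul h0 (hQ.pow j).ne_zero, hQ.natDegree_pow, hQd]
  calc P.natDegree + j * d < d + j * d := by omega
    _ = (j + 1) * d := by ring
    _ ≤ a * d := Nat.mul_le_mul_right _ hj

/-- The largest numeral with digits below a_k is ∑ (a_k - 1) D_k = D_t - 1. -/
theorem Std_degree_lt {D : ℕ → ℕ} (h0 : D 0 = 1) : ∀ t, (∀ k < t, (G k).Monic) →
    (∀ k < t, (G k).natDegree = D k) → (∀ k < t, D (k + 1) = a k * D k) →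
    ∀ M ∈ Std I G a t, M.degree < D t
  | 0, _, _, _ => by
    rintro _ ⟨i, hi, rfl⟩
    rw [h0]
    exact degree_C_le.trans_lt (by norm_num)
  | t + 1, hm, hd, hD => by
    rintro _ ⟨M, hM, j, hj, rfl⟩
    rw [hD t (by omega)]
    exact degree_mul_pow_lt (hm t (by omega)) (hd t (by omega)) (Std_degree_lt h0 t
      (fun k hk => hm k (by omega)) (fun k hk => hd k (by omega)) (fun k hk => hD k (by omega))
      M hM) hj

theorem degree_lt_of_mem_span {S : Set (LRing K)} {d : ℕ} (hS : ∀ M ∈ S, M.degree < d)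
    {P : LRing K} (hP : P ∈ Submodule.span K S) : P.degree < d := by
  induction hP using Submodule.span_induction with
  | mem M hM => exact hS M hM
  | zero => rw [degree_zero]; exact WithBot.bot_lt_coe d
  | add _ _ _ _ h₁ h₂ => exact (degree_add_le _ _).trans_lt (max_lt h₁ h₂)
  | smul c _ _ h => exact (degree_smul_le _ _).trans_lt h

/-- A polynomial of small degree is a combination of standard monomials. -/
theorem mem_span_Std {D : ℕ → ℕ} (hB : ∀ x ∈ B, C x ∈ Submodule.span K (Std I G a 0))
    (h0 : D 0 = 1) : ∀ t, (∀ k < t, (G k).Monic) →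
    (∀ k < t, (G k).natDegree = D k) → (∀ k < t, D (k + 1) = a k * D k) →
    (∀ k < t, CoeffIn B (G k)) → ∀ P : LRing K, CoeffIn B P → P.degree < D t →
      P ∈ Submodule.span K (Std I G a t)
  | 0, _, _, _, _ => by
    intro P hP hd
    rw [h0] at hd
    rw [eq_C_of_natDegree_eq_zero (p := P) (by
      by_cases hP0 : P = 0
      · rw [hP0, natDegree_zero]
      · rw [← natDegree_lt_iff_degree_lt hP0] at hd
        omega)]
    exact hB _ (hP 0)
  | t + 1, hm, hd, hD, hG => by
    have ih := mem_span_Std hB h0 t (fun k hk => hm k (by omega)) (fun k hk => hd k (by omega))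
      (fun k hk => hD k (by omega)) (fun k hk => hG k (by omega))
    have hmt := hm t (by omega)
    have hdt := hd t (by omega)
    -- Induction on the number of digits allowed for G_t: the remainder modulo G_t is the digit 0,
    -- the quotient needs one digit less.
    have hlow : ∀ b ≤ a t, ∀ P : LRing K, CoeffIn B P → P.degree < (b * D t : ℕ) →
        P ∈ Submodule.span K {M | ∃ M' ∈ Std I G a t, ∃ j < b, M = M' * G t ^ j} := by
      intro b
      induction b with
      | zero =>
        intro _ P _ hP
        rw [zero_mul] at hP
        rw [degree_eq_bot.1 (Nat.WithBot.lt_zero_iff.1 hP)]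
        exact Submodule.zero_mem _
      | succ b ihb =>
        intro hb P hP hPd
        obtain ⟨hc1, hc2⟩ := hP.mod_div (hG t (by omega)) hmt
        have hdeg : (P %ₘ G t).degree < D t := by
          have := degree_modByMonic_lt P hmt
          rwa [degree_eq_natDegree hmt.ne_zero, hdt] at this
        have hdeg2 : (P /ₘ G t).degree < (b * D t : ℕ) := by
          by_cases hz : P /ₘ G t = 0
          · rw [hz, degree_zero]
            exact WithBot.bot_lt_coe _
          have hP0 : P ≠ 0 := fun h => hz (by rw [h, zero_divByMonic])
          have hle : (G t).natDegree ≤ P.natDegree := by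
            by_contra hlt
            exact hz ((divByMonic_eq_zero_iff hmt).2 (degree_lt_degree (not_le.1 hlt)))
          rw [← natDegree_lt_iff_degree_lt hz, natDegree_divByMonic _ hmt, hdt]
          rw [← natDegree_lt_iff_degree_lt hP0, add_mul, one_mul] at hPd
          omega
        rw [← modByMonic_add_div P (G t)]
        refine Submodule.add_mem _ ?_ ?_
        · refine Submodule.span_mono ?_ (ih _ hc1 hdeg)
          exact fun M hM => ⟨M, hM, 0, by omega, by simp⟩
        · have h1 := Submodule.mem_map_of_mem (f := LinearMap.mulLeft K (G t))
            (ihb (by omega) _ hc2 hdeg2)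
          rw [Submodule.map_span] at h1
          refine Submodule.span_mono ?_ h1
          rintro _ ⟨_, ⟨M, hM, j, hj, rfl⟩, rfl⟩
          refine ⟨M, hM, j + 1, by omega, ?_⟩
          rw [LinearMap.mulLeft_apply]
          ring
    intro P hP hPd
    rw [hD t (by omega)] at hPd
    exact hlow (a t) le_rfl P hP hPd

/-- The polynomials in `f`, as a subalgebra of the Laurent polynomials. -/
noncomputable def polyPart (K : Type*) [Field K] : Subalgebra K (LaurentPolynomial K) :=
  (toLaurentAlg (R := K)).range

/-- The forward direction serves at the very end, to read off the sign of the exponent of f. -/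
theorem T_mem_polyPart {i : ℤ} : (LaurentPolynomial.T i : LaurentPolynomial K) ∈ polyPart K ↔
    0 ≤ i := by
  constructor
  · rintro ⟨q, hq⟩
    by_contra hi
    have h1 : (LaurentPolynomial.T i : LaurentPolynomial K).coeff i = 0 := by
      rw [← hq, AlgHom.toRingHom_eq_coe, RingHom.coe_coe, toLaurentAlg_apply]
      by_contra h
      have h2 := Finsupp.mem_support_iff.2 h
      rw [LaurentPolynomial.support_coeff_toLaurent] at h2
      obtain ⟨k, -, hk⟩ := Finset.mem_map.1 h2
      simp at hk
      omega
    simp at h1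
  · intro hi
    refine ⟨X ^ i.toNat, ?_⟩
    rw [AlgHom.toRingHom_eq_coe, RingHom.coe_coe, toLaurentAlg_apply, toLaurent_X_pow,
      Int.toNat_of_nonneg hi]

theorem C_mem_span_of_mem_polyPart {x : LaurentPolynomial K} (hx : x ∈ polyPart K) :
    C x ∈ Submodule.span K (Std {i | 0 ≤ i} G a 0) := by
  obtain ⟨q, rfl⟩ := hx
  induction q using Polynomial.induction_on' with
  | add p q hp hq => rw [map_add, C_add]; exact Submodule.add_mem _ hp hq
  | monomial k c =>
    rw [AlgHom.toRingHom_eq_coe, RingHom.coe_coe, toLaurentAlg_apply, ← C_mul_X_pow_eq_monomial,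
      toLaurent_C_mul_X_pow, ← LaurentPolynomial.smul_eq_C_mul, ← smul_C]
    exact Submodule.smul_mem _ _ (Submodule.subset_span ⟨k, Int.natCast_nonneg k, rfl⟩)

theorem C_mem_span (x : LaurentPolynomial K) :
    C x ∈ Submodule.span K (Std Set.univ G a 0) := by
  induction x using LaurentPolynomial.induction_on' with
  | add p q hp hq => rw [C_add]; exact Submodule.add_mem _ hp hq
  | C_mul_T k c =>
    rw [← LaurentPolynomial.smul_eq_C_mul, ← smul_C]
    exact Submodule.smul_mem _ _ (Submodule.subset_span ⟨k, Set.mem_univ k, rfl⟩)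

end PolynomialLemmas

/-! ### The z-degree as a valuation on L -/

section Degree

variable {K : Type*} [Field K] {f g : K[X]} {hf : f ≠ 0}

theorem toRat_C_C (c : K) : toRat f g hf (C (LaurentPolynomial.C c)) = RatFunc.C c := by
  simp [toRat]

theorem toRat_smul (c : K) (P : LRing K) :
    toRat f g hf (c • P) = RatFunc.C c * toRat f g hf P := by
  rw [← toRat_C_C (f := f) (g := g) (hf := hf) c, ← map_mul]
  congr 1
  ext1 k
  rw [coeff_smul, coeff_C_mul, LaurentPolynomial.smul_eq_C_mul]

theorem toRat_T (i : ℤ) : toRat f g hf (C (LaurentPolynomial.T i)) =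
    (algebraMap K[X] (RatFunc K) f) ^ i := by
  simp [toRat, LaurentPolynomial.eval₂_T]

theorem toRat_varG : toRat f g hf (varG K) = algebraMap K[X] (RatFunc K) g := by
  simp [toRat, varG]

theorem toRat_X : toRat f g hf X = algebraMap K[X] (RatFunc K) g := toRat_varG

theorem toRat_T_ne_zero (i : ℤ) : toRat f g hf (C (LaurentPolynomial.T i)) ≠ 0 := by
  rw [toRat_T]
  exact zpow_ne_zero _ (RatFunc.algebraMap_ne_zero hf)

theorem intDegree_pow {x : RatFunc K} (hx : x ≠ 0) (k : ℕ) :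
    (x ^ k).intDegree = k * x.intDegree := by
  induction k with
  | zero => simp
  | succ k ih =>
    rw [pow_succ, RatFunc.intDegree_mul (pow_ne_zero _ hx) hx, ih]
    push_cast
    ring

theorem intDegree_zpow {x : RatFunc K} (hx : x ≠ 0) (i : ℤ) :
    (x ^ i).intDegree = i * x.intDegree := by
  obtain ⟨k, rfl | rfl⟩ := Int.eq_nat_or_neg i
  · rw [zpow_natCast, intDegree_pow hx]
  · rw [zpow_neg, zpow_natCast, RatFunc.intDegree_inv, intDegree_pow hx]
    ring

/-- Two rational functions of the same degree have proportional leading terms. -/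
theorem exists_sub_C_mul_intDegree_lt {x y : RatFunc K} (hx : x ≠ 0) (hy : y ≠ 0)
    (hxy : x.intDegree = y.intDegree) :
    ∃ c : K, x - RatFunc.C c * y = 0 ∨ (x - RatFunc.C c * y).intDegree < x.intDegree := by
  set q := x / y with hq
  have hq0 : q ≠ 0 := div_ne_zero hx hy
  have hqd : q.intDegree = 0 := by rw [hq, RatFunc.intDegree_div hx hy, hxy, sub_self]
  have hnd : q.num.degree = q.denom.degree := by
    rw [RatFunc.intDegree, sub_eq_zero, Nat.cast_inj] at hqd
    rw [degree_eq_natDegree (RatFunc.num_ne_zero hq0), degree_eq_natDegree (RatFunc.denom_ne_zero q),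
      hqd]
  set c := q.num.leadingCoeff with hc
  have hc0 : c ≠ 0 := leadingCoeff_ne_zero.2 (RatFunc.num_ne_zero hq0)
  refine ⟨c, ?_⟩
  by_cases h0 : x - RatFunc.C c * y = 0
  · exact Or.inl h0
  right
  set r := q.num - C c * q.denom with hr
  have hd0 : algebraMap K[X] (RatFunc K) q.denom ≠ 0 :=
    RatFunc.algebraMap_ne_zero (RatFunc.denom_ne_zero q)
  have hqr : x - RatFunc.C c * y =
      algebraMap K[X] (RatFunc K) r / algebraMap K[X] (RatFunc K) q.denom * y := by
    have h1 : x = q * y := by rw [hq, div_mul_cancel₀ _ hy]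
    have h2 : q - RatFunc.C c =
        algebraMap K[X] (RatFunc K) r / algebraMap K[X] (RatFunc K) q.denom := by
      rw [eq_div_iff hd0, hr, map_sub, map_mul, RatFunc.algebraMap_C, sub_mul]
      congr 1
      conv_lhs => rw [← RatFunc.num_div_denom q]
      rw [RatFunc.num_div_denom]
      exact (div_eq_iff hd0).1 (RatFunc.num_div_denom q) |>.symm
    rw [← h2, sub_mul, ← h1]
  have hr0 : r ≠ 0 := by
    intro h
    rw [h, map_zero, zero_div, zero_mul] at hqr
    exact h0 hqr
  have hrd : r.natDegree < q.denom.natDegree := by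
    have h1 : r.degree < q.num.degree := by
      refine degree_sub_lt_left ?_ (RatFunc.num_ne_zero hq0) ?_
      · rw [degree_C_mul hc0, hnd]
      · rw [leadingCoeff_mul, leadingCoeff_C, (RatFunc.monic_denom q).leadingCoeff, mul_one]
    rw [hnd] at h1
    exact natDegree_lt_natDegree hr0 h1
  rw [hqr, RatFunc.intDegree_mul (div_ne_zero (RatFunc.algebraMap_ne_zero hr0) hd0) hy,
    RatFunc.intDegree_div (RatFunc.algebraMap_ne_zero hr0) hd0, RatFunc.intDegree_polynomial,
    RatFunc.intDegree_polynomial, hxy]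
  omega

open Classical in
/-- The `z`-degree, with the value `⊥` on the elements which vanish in `K(z)`. -/
noncomputable def vdeg (f g : K[X]) (hf : f ≠ 0) (P : LRing K) : WithBot ℤ :=
  if toRat f g hf P = 0 then ⊥ else (zdeg f g hf P : ℤ)

theorem vdeg_eq_bot {P : LRing K} : vdeg f g hf P = ⊥ ↔ toRat f g hf P = 0 := by
  unfold vdeg
  split_ifs with h <;> simp [h]

theorem vdeg_of_ne {P : LRing K} (h : toRat f g hf P ≠ 0) :
    vdeg f g hf P = (zdeg f g hf P : ℤ) := if_neg h

theorem vdeg_eq_coe {P : LRing K} {m : ℤ} :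
    vdeg f g hf P = m ↔ toRat f g hf P ≠ 0 ∧ zdeg f g hf P = m := by
  by_cases h : toRat f g hf P = 0
  · rw [vdeg_eq_bot.2 h]
    simp [h]
  · rw [vdeg_of_ne h]
    simp [h]

theorem vdeg_zero : vdeg f g hf 0 = ⊥ := vdeg_eq_bot.2 (map_zero _)

theorem vdeg_mul (P Q : LRing K) : vdeg f g hf (P * Q) = vdeg f g hf P + vdeg f g hf Q := by
  by_cases hP : toRat f g hf P = 0
  · rw [vdeg_eq_bot.2 hP, vdeg_eq_bot.2 (by rw [map_mul, hP, zero_mul]), WithBot.bot_add]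
  by_cases hQ : toRat f g hf Q = 0
  · rw [vdeg_eq_bot.2 hQ, vdeg_eq_bot.2 (by rw [map_mul, hQ, mul_zero]), WithBot.add_bot]
  rw [vdeg_of_ne hP, vdeg_of_ne hQ, ← WithBot.coe_add, vdeg_eq_coe, map_mul]
  exact ⟨mul_ne_zero hP hQ, by rw [zdeg, map_mul, RatFunc.intDegree_mul hP hQ]; rfl⟩

theorem vdeg_T (i : ℤ) : vdeg f g hf (C (LaurentPolynomial.T i)) = (i * f.natDegree : ℤ) := by
  rw [vdeg_eq_coe]
  exact ⟨toRat_T_ne_zero i, by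
    rw [zdeg, toRat_T, intDegree_zpow (RatFunc.algebraMap_ne_zero hf),
      RatFunc.intDegree_polynomial]⟩

theorem vdeg_one : vdeg f g hf 1 = (0 : ℤ) := by
  have := vdeg_T (f := f) (g := g) (hf := hf) 0
  rwa [LaurentPolynomial.T_zero, C_1, zero_mul] at this

theorem vdeg_pow {P : LRing K} {m : ℤ} (h : vdeg f g hf P = m) (k : ℕ) :
    vdeg f g hf (P ^ k) = (k * m : ℤ) := by
  induction k with
  | zero => simpa using vdeg_one
  | succ k ih =>
    rw [pow_succ, vdeg_mul, ih, h, ← WithBot.coe_add]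
    congr 1
    push_cast
    ring

theorem vdeg_smul {c : K} (hc : c ≠ 0) (P : LRing K) :
    vdeg f g hf (c • P) = vdeg f g hf P := by
  have hC : RatFunc.C c ≠ 0 := (_root_.map_ne_zero _).2 hc
  by_cases hP : toRat f g hf P = 0
  · rw [vdeg_eq_bot.2 hP, vdeg_eq_bot.2 (by rw [toRat_smul, hP, mul_zero])]
  rw [vdeg_of_ne hP, vdeg_eq_coe, toRat_smul]
  exact ⟨mul_ne_zero hC hP, by
    rw [zdeg, toRat_smul, RatFunc.intDegree_mul hC hP, RatFunc.intDegree_C, zero_add]; rfl⟩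

theorem vdeg_smul_le (c : K) (P : LRing K) : vdeg f g hf (c • P) ≤ vdeg f g hf P := by
  by_cases hc : c = 0
  · rw [hc, zero_smul, vdeg_zero]
    exact bot_le
  · rw [vdeg_smul hc]

theorem vdeg_neg (P : LRing K) : vdeg f g hf (-P) = vdeg f g hf P := by
  rw [← neg_one_smul K P, vdeg_smul (neg_ne_zero.2 one_ne_zero)]

theorem vdeg_add_le (P Q : LRing K) :
    vdeg f g hf (P + Q) ≤ max (vdeg f g hf P) (vdeg f g hf Q) := by
  by_cases hPQ : toRat f g hf (P + Q) = 0
  · rw [vdeg_eq_bot.2 hPQ]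
    exact bot_le
  by_cases hP : toRat f g hf P = 0
  · refine le_max_of_le_right (le_of_eq ?_)
    rw [vdeg, vdeg, zdeg, zdeg, map_add, hP, zero_add]
  by_cases hQ : toRat f g hf Q = 0
  · refine le_max_of_le_left (le_of_eq ?_)
    rw [vdeg, vdeg, zdeg, zdeg, map_add, hQ, add_zero]
  rw [vdeg_of_ne hPQ, vdeg_of_ne hP, vdeg_of_ne hQ, ← WithBot.coe_max, WithBot.coe_le_coe]
  rw [zdeg, zdeg, zdeg, map_add]
  rw [map_add] at hPQ
  exact RatFunc.intDegree_add_le hQ hPQ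

theorem vdeg_sub_le (P Q : LRing K) :
    vdeg f g hf (P - Q) ≤ max (vdeg f g hf P) (vdeg f g hf Q) := by
  rw [sub_eq_add_neg, ← vdeg_neg Q]
  exact vdeg_add_le _ _

theorem vdeg_add_eq_left {P Q : LRing K} (h : vdeg f g hf Q < vdeg f g hf P) :
    vdeg f g hf (P + Q) = vdeg f g hf P := by
  refine le_antisymm ((vdeg_add_le P Q).trans (max_le le_rfl h.le)) ?_
  by_contra hlt
  have := vdeg_sub_le (f := f) (g := g) (hf := hf) (P + Q) Q
  rw [add_sub_cancel_right] at this
  exact absurd (this.trans_lt (max_lt (not_le.1 hlt) h)) (lt_irrefl _)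

theorem vdeg_sub_eq_left {P Q : LRing K} (h : vdeg f g hf Q < vdeg f g hf P) :
    vdeg f g hf (P - Q) = vdeg f g hf P := by
  rw [sub_eq_add_neg]
  exact vdeg_add_eq_left (by rwa [vdeg_neg])

theorem exists_vdeg_sub_smul_lt {P Q : LRing K} (h : vdeg f g hf P = vdeg f g hf Q)
    (hP : toRat f g hf P ≠ 0) : ∃ c : K, vdeg f g hf (P - c • Q) < vdeg f g hf P := by
  have hQ : toRat f g hf Q ≠ 0 := by rwa [ne_eq, ← vdeg_eq_bot, ← h, vdeg_eq_bot]
  rw [vdeg_of_ne hP, vdeg_of_ne hQ, WithBot.coe_inj] at h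
  obtain ⟨c, hc⟩ := exists_sub_C_mul_intDegree_lt hP hQ h
  refine ⟨c, ?_⟩
  rw [vdeg_of_ne hP]
  rw [← toRat_smul, ← map_sub] at hc
  by_cases h0 : toRat f g hf (P - c • Q) = 0
  · rw [vdeg_eq_bot.2 h0]
    exact WithBot.bot_lt_coe _
  · rw [vdeg_of_ne h0, WithBot.coe_lt_coe]
    exact hc.resolve_left h0

/-- Combinations of elements of degree smaller than `b` have degree smaller than `b`. -/
theorem vdeg_lt_of_mem_span {S : Set (LRing K)} {b : WithBot ℤ} (hb : ⊥ < b)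
    (hS : ∀ M ∈ S, vdeg f g hf M < b) {P : LRing K} (hP : P ∈ Submodule.span K S) :
    vdeg f g hf P < b := by
  induction hP using Submodule.span_induction with
  | mem M hM => exact hS M hM
  | zero => rwa [vdeg_zero]
  | add _ _ _ _ h₁ h₂ => exact (vdeg_add_le _ _).trans_lt (max_lt h₁ h₂)
  | smul c _ _ h => exact (vdeg_smul_le _ _).trans_lt h

theorem vdeg_le_of_mem_span {S : Set (LRing K)} {b : WithBot ℤ}
    (hS : ∀ M ∈ S, vdeg f g hf M ≤ b) {P : LRing K} (hP : P ∈ Submodule.span K S) :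
    vdeg f g hf P ≤ b := by
  induction hP using Submodule.span_induction with
  | mem M hM => exact hS M hM
  | zero => rw [vdeg_zero]; exact bot_le
  | add _ _ _ _ h₁ h₂ => exact (vdeg_add_le _ _).trans (max_le h₁ h₂)
  | smul c _ _ h => exact (vdeg_smul_le _ _).trans h

/-- Elements of pairwise different degrees: every combination has a leading term. -/
theorem exists_leading_term {S : Set (LRing K)} (hS : ∀ M ∈ S, toRat f g hf M ≠ 0)
    (hinj : Set.InjOn (vdeg f g hf) S) {P : LRing K} (hP : P ∈ Submodule.span K S)
    (h0 : P ≠ 0) :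
    ∃ M ∈ S, ∃ c : K, c ≠ 0 ∧ vdeg f g hf P = vdeg f g hf M ∧
      P - c • M ∈ Submodule.span K {M' ∈ S | vdeg f g hf M' < vdeg f g hf M} := by
  classical
  obtain ⟨l, rfl⟩ := (Finsupp.mem_span_iff_linearCombination K S P).1 hP
  have hl : l.support.Nonempty := by
    rw [Finsupp.support_nonempty_iff]
    rintro rfl
    exact h0 (map_zero _)
  -- By injectivity the maximum is attained only once, so the leading term cannot cancel.
  obtain ⟨M, hM, hmax⟩ := Finset.exists_max_image l.support (fun M => vdeg f g hf (M : LRing K)) hl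
  have hc : l M ≠ 0 := Finsupp.mem_support_iff.1 hM
  have hrest : Finsupp.linearCombination K ((↑) : S → LRing K) l - l M • (M : LRing K) ∈
      Submodule.span K {M' ∈ S | vdeg f g hf M' < vdeg f g hf (M : LRing K)} := by
    rw [Finsupp.linearCombination_apply, Finsupp.sum, ← Finset.add_sum_erase _ _ hM,
      add_sub_cancel_left]
    refine Submodule.sum_mem _ fun M' hM' => Submodule.smul_mem _ _ (Submodule.subset_span ?_)
    obtain ⟨hne, hM'⟩ := Finset.mem_erase.1 hM'
    exact ⟨M'.2, lt_of_le_of_ne (hmax M' hM') fun h => hne (Subtype.ext (hinj M'.2 M.2 h))⟩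
  have hlt : vdeg f g hf (Finsupp.linearCombination K ((↑) : S → LRing K) l - l M • (M : LRing K)) <
      vdeg f g hf (M : LRing K) :=
    vdeg_lt_of_mem_span (bot_lt_iff_ne_bot.2 fun h => hS M M.2 (vdeg_eq_bot.1 h))
      (fun M' hM' => hM'.2) hrest
  refine ⟨M, M.2, l M, hc, ?_, hrest⟩
  have h := vdeg_add_eq_left (f := f) (g := g) (hf := hf) (P := l M • (M : LRing K)) (Q :=
    Finsupp.linearCombination K ((↑) : S → LRing K) l - l M • (M : LRing K))
    (by rwa [vdeg_smul hc])
  rw [add_sub_cancel, vdeg_smul hc] at h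
  exact h

end Degree

/-! ### Numeration of z-degrees by standard monomials -/

section Numeration

/-- With d' = gcd(d, m) and a = d/d', the number m/d' is invertible modulo a. A Bézout coefficient
provides the inverse, and reduction modulo a makes the digit smaller than a. -/
theorem exists_lt_dvd_sub_mul {d : ℕ} (hd : 0 < d) {m N : ℤ}
    (hN : (Nat.gcd d m.natAbs : ℤ) ∣ N) :
    ∃ j < d / Nat.gcd d m.natAbs, (d : ℤ) ∣ N - j * m := by
  set d' := Nat.gcd d m.natAbs with hd'
  have hd'0 : 0 < d' := Nat.gcd_pos_of_pos_left _ hd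
  have had : d / d' * d' = d := Nat.div_mul_cancel (Nat.gcd_dvd_left _ _)
  set a := d / d' with ha
  have ha0 : 0 < a := Nat.pos_of_ne_zero fun h => by rw [h, zero_mul] at had; omega
  obtain ⟨μ, hμ⟩ : (d' : ℤ) ∣ m := Int.natCast_dvd.2 (Nat.gcd_dvd_right _ _)
  obtain ⟨q, hq⟩ := hN
  have hb := Int.gcd_eq_gcd_ab (d : ℤ) m
  have hg : (Int.gcd (d : ℤ) m : ℤ) = d' := rfl
  rw [hg] at hb
  set x := Int.gcdA (d : ℤ) m
  set y := Int.gcdB (d : ℤ) m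
  have hnn : 0 ≤ (y * q) % (a : ℤ) := Int.emod_nonneg _ (by omega)
  have hlt : (y * q) % (a : ℤ) < a := Int.emod_lt_of_pos _ (by omega)
  refine ⟨((y * q) % (a : ℤ)).toNat, by omega, x * q + (y * q / a) * μ, ?_⟩
  rw [Int.toNat_of_nonneg hnn]
  have h1 : (d : ℤ) * μ = a * m := by
    rw [hμ, ← had]
    push_cast
    ring
  have h2 := Int.mul_ediv_add_emod (y * q) a
  rw [hq]
  linear_combination q * hb - (y * q / (a : ℤ)) * h1 - m * h2

theorem eq_of_dvd_sub_mul {d : ℕ} (hd : 0 < d) {m : ℤ} {j j' : ℕ}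
    (hj : j < d / Nat.gcd d m.natAbs) (hj' : j' < d / Nat.gcd d m.natAbs)
    (h : (d : ℤ) ∣ (j - j' : ℤ) * m) : j = j' := by
  have hd'0 : 0 < Nat.gcd d m.natAbs := Nat.gcd_pos_of_pos_left _ hd
  have hcop : Nat.Coprime (d / Nat.gcd d m.natAbs) (m.natAbs / Nat.gcd d m.natAbs) :=
    Nat.coprime_div_gcd_div_gcd hd'0
  set d' := Nat.gcd d m.natAbs with hd'
  have had : d / d' * d' = d := Nat.div_mul_cancel (Nat.gcd_dvd_left _ _)
  have hmd : m.natAbs / d' * d' = m.natAbs := Nat.div_mul_cancel (Nat.gcd_dvd_right _ _)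
  set a := d / d' with ha
  have h1 : a * d' ∣ ((j : ℤ) - j').natAbs * (m.natAbs / d') * d' := by
    rw [mul_assoc, hmd, had, ← Int.natAbs_mul]
    exact Int.natCast_dvd.1 h
  have h2 : a ∣ ((j : ℤ) - j').natAbs :=
    hcop.dvd_of_dvd_mul_right (Nat.dvd_of_mul_dvd_mul_right hd'0 h1)
  have h3 : ((j : ℤ) - j').natAbs < a := by omega
  have := Nat.eq_zero_of_dvd_of_lt h2 h3
  omega

variable {K : Type*} [Field K] {f g : K[X]} {hf : f ≠ 0} {G : ℕ → LRing K}

theorem gcdSeq_pos (hn : 0 < f.natDegree) : ∀ k, 0 < gcdSeq f g hf G k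
  | 0 => hn
  | k + 1 => Nat.gcd_pos_of_pos_left _ (gcdSeq_pos hn k)

theorem gcdSeq_succ_dvd (k : ℕ) : gcdSeq f g hf G (k + 1) ∣ gcdSeq f g hf G k :=
  Nat.gcd_dvd_left _ _

theorem gcdSeq_dvd {s t : ℕ} (hst : s ≤ t) : gcdSeq f g hf G t ∣ gcdSeq f g hf G s := by
  induction t, hst using Nat.le_induction with
  | base => exact dvd_rfl
  | succ t _ ih => exact (gcdSeq_succ_dvd t).trans ih

theorem ratioSeq_mul (k : ℕ) :
    ratioSeq f g hf G k * gcdSeq f g hf G (k + 1) = gcdSeq f g hf G k :=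
  Nat.div_mul_cancel (gcdSeq_succ_dvd k)

theorem ratioSeq_pos (hn : 0 < f.natDegree) (k : ℕ) : 0 < ratioSeq f g hf G k := by
  refine Nat.pos_of_ne_zero fun h => ?_
  have := ratioSeq_mul (f := f) (g := g) (hf := hf) (G := G) k
  rw [h, zero_mul] at this
  exact (gcdSeq_pos hn k).ne this

theorem gcdSeq_succ_dvd_zdeg (k : ℕ) : (gcdSeq f g hf G (k + 1) : ℤ) ∣ zdeg f g hf (G k) :=
  Int.natCast_dvd.2 (Nat.gcd_dvd_right _ _)

theorem isStandard_iff {t : ℕ} {M : LRing K} :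
    IsStandard f g hf G t M ↔ M ∈ Std Set.univ G (ratioSeq f g hf G) t := by
  induction t generalizing M with
  | zero =>
    constructor
    · rintro ⟨i, j, -, rfl⟩
      exact ⟨i, trivial, by simp⟩
    · rintro ⟨i, -, rfl⟩
      exact ⟨i, fun _ => 0, by simp, by simp⟩
  | succ t ih =>
    constructor
    · rintro ⟨i, j, hj, rfl⟩
      refine ⟨_, ih.1 ⟨i, j, fun k hk => hj k (by omega), rfl⟩, j t, hj t (by omega), ?_⟩
      rw [Finset.prod_range_succ, mul_assoc]
    · rintro ⟨M, hM, l, hl, rfl⟩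
      obtain ⟨i, j, hj, rfl⟩ := ih.2 hM
      refine ⟨i, fun k => if k = t then l else j k, fun k hk => ?_, ?_⟩
      · dsimp only
        split_ifs with h
        · rwa [h]
        · exact hj k (by omega)
      · rw [Finset.prod_range_succ, mul_assoc]
        congr 2
        · refine Finset.prod_congr rfl fun k hk => ?_
          simp [(Finset.mem_range.1 hk).ne]
        · simp

variable {I : Set ℤ}

theorem Std_toRat_ne_zero {a : ℕ → ℕ} : ∀ t, (∀ k < t, toRat f g hf (G k) ≠ 0) →
    ∀ M ∈ Std I G a t, toRat f g hf M ≠ 0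
  | 0, _ => by
    rintro _ ⟨i, -, rfl⟩
    exact toRat_T_ne_zero i
  | t + 1, h => by
    rintro _ ⟨M, hM, j, -, rfl⟩
    rw [map_mul, map_pow]
    exact mul_ne_zero (Std_toRat_ne_zero t (fun k hk => h k (by omega)) M hM)
      (pow_ne_zero _ (h t (by omega)))

theorem vdeg_Std : ∀ t, (∀ k < t, toRat f g hf (G k) ≠ 0) →
    ∀ M ∈ Std I G (ratioSeq f g hf G) t,
      ∃ N : ℤ, vdeg f g hf M = N ∧ (gcdSeq f g hf G t : ℤ) ∣ N
  | 0, _ => by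
    rintro _ ⟨i, -, rfl⟩
    exact ⟨_, vdeg_T i, Dvd.intro_left _ rfl⟩
  | t + 1, h => by
    rintro _ ⟨M, hM, j, -, rfl⟩
    obtain ⟨N, hN, hd⟩ := vdeg_Std t (fun k hk => h k (by omega)) M hM
    refine ⟨N + j * zdeg f g hf (G t), ?_, ?_⟩
    · rw [vdeg_mul, hN, vdeg_pow (vdeg_of_ne (h t (by omega))), ← WithBot.coe_add]
    · exact dvd_add ((Int.natCast_dvd_natCast.2 (gcdSeq_succ_dvd t)).trans hd)
        (Dvd.dvd.mul_left (gcdSeq_succ_dvd_zdeg t) _)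

/-- Every multiple of `d_{t-1}` is the degree of a `(t-1)`-standard monomial. -/
theorem exists_Std_vdeg_eq (hn : 0 < f.natDegree) : ∀ t, (∀ k < t, toRat f g hf (G k) ≠ 0) →
    ∀ N : ℤ, (gcdSeq f g hf G t : ℤ) ∣ N →
      ∃ M ∈ Std Set.univ G (ratioSeq f g hf G) t, vdeg f g hf M = N
  | 0, _, N, hN => by
    obtain ⟨i, rfl⟩ := hN
    exact ⟨_, ⟨i, trivial, rfl⟩, by rw [vdeg_T, mul_comm]; rfl⟩
  | t + 1, h, N, hN => by
    obtain ⟨j, hj, hd⟩ := exists_lt_dvd_sub_mul (gcdSeq_pos hn t) hN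
    obtain ⟨M, hM, hMd⟩ := exists_Std_vdeg_eq hn t (fun k hk => h k (by omega)) _ hd
    refine ⟨M * G t ^ j, ⟨M, hM, j, hj, rfl⟩, ?_⟩
    rw [vdeg_mul, hMd, vdeg_pow (vdeg_of_ne (h t (by omega))), ← WithBot.coe_add,
      sub_add_cancel]

/-- All factors but the last contribute multiples of d_{t-1}, so the degree modulo d_{t-1}
determines the last digit; then the remaining digits follow inductively. -/
theorem Std_injOn (hn : 0 < f.natDegree) : ∀ t, (∀ k < t, toRat f g hf (G k) ≠ 0) →
    Set.InjOn (vdeg f g hf) (Std I G (ratioSeq f g hf G) t)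
  | 0, _ => by
    rintro _ ⟨i, -, rfl⟩ _ ⟨i', -, rfl⟩ h
    rw [vdeg_T, vdeg_T, WithBot.coe_inj] at h
    rw [mul_right_cancel₀ (by positivity) h]
  | t + 1, hG => by
    rintro _ ⟨M, hM, j, hj, rfl⟩ _ ⟨M', hM', j', hj', rfl⟩ h
    have hG' := fun k (hk : k < t) => hG k (by omega)
    obtain ⟨N, hN, hd⟩ := vdeg_Std t hG' M hM
    obtain ⟨N', hN', hd'⟩ := vdeg_Std t hG' M' hM'
    rw [vdeg_mul, vdeg_mul, hN, hN', vdeg_pow (vdeg_of_ne (hG t (by omega))),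
      vdeg_pow (vdeg_of_ne (hG t (by omega))), ← WithBot.coe_add, ← WithBot.coe_add,
      WithBot.coe_inj] at h
    have hjj : j = j' := by
      refine eq_of_dvd_sub_mul (gcdSeq_pos (g := g) (hf := hf) (G := G) hn t)
        (m := zdeg f g hf (G t)) hj hj' ?_
      have : ((j : ℤ) - j') * zdeg f g hf (G t) = N' - N := by linear_combination h
      rw [this]
      exact dvd_sub hd' hd
    subst hjj
    have : N = N' := by linear_combination h
    rw [Std_injOn hn t hG' hM hM' (by rw [hN, hN', this])]

/-- A non-zero combination of `(t-1)`-standard monomials has a degree divisible by `d_{t-1}`. -/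
theorem vdeg_of_mem_span_Std (hn : 0 < f.natDegree) {t : ℕ}
    (hG : ∀ k < t, toRat f g hf (G k) ≠ 0) {P : LRing K}
    (hP : P ∈ Submodule.span K (Std I G (ratioSeq f g hf G) t)) (h0 : P ≠ 0) :
    ∃ N : ℤ, vdeg f g hf P = N ∧ (gcdSeq f g hf G t : ℤ) ∣ N := by
  obtain ⟨M, hM, c, -, h, -⟩ := exists_leading_term (Std_toRat_ne_zero t hG)
    (Std_injOn hn t hG) hP h0
  rw [h]
  exact vdeg_Std t hG M hM

/-- `dim s = a₀ ⋯ a_{s-1}`, the degree of `g_s` in the variable `g`. -/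
noncomputable def dimSeq (f g : K[X]) (hf : f ≠ 0) (G : ℕ → LRing K) (s : ℕ) : ℕ :=
  ∏ k ∈ Finset.range s, ratioSeq f g hf G k

theorem dimSeq_zero : dimSeq f g hf G 0 = 1 := by simp [dimSeq]

theorem dimSeq_succ (s : ℕ) :
    dimSeq f g hf G (s + 1) = ratioSeq f g hf G s * dimSeq f g hf G s := by
  rw [dimSeq, Finset.prod_range_succ, mul_comm]; rfl

theorem dimSeq_mul_gcdSeq (s : ℕ) : dimSeq f g hf G s * gcdSeq f g hf G s = f.natDegree := by
  induction s with
  | zero => rw [dimSeq_zero, one_mul]; rfl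
  | succ s ih => rw [dimSeq_succ, mul_right_comm, ratioSeq_mul, mul_comm, ih]

theorem dimSeq_pos (hn : 0 < f.natDegree) (s : ℕ) : 0 < dimSeq f g hf G s :=
  Finset.prod_pos fun k _ => ratioSeq_pos hn k

/-- The elements `g₀, …, g_{s-1}` are monic of the expected degrees in the variable `g` and
non-zero in `K(z)`. -/
structure Regular (f g : K[X]) (hf : f ≠ 0) (G : ℕ → LRing K) (s : ℕ) : Prop where
  pos : 0 < f.natDegree
  ne_zero : ∀ k < s, toRat f g hf (G k) ≠ 0
  monic : ∀ k < s, (G k).Monic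
  natDegree : ∀ k < s, (G k).natDegree = dimSeq f g hf G k

theorem Regular.mono {s t : ℕ} (h : Regular f g hf G t) (hst : s ≤ t) : Regular f g hf G s :=
  ⟨h.pos, fun k hk => h.ne_zero k (by omega), fun k hk => h.monic k (by omega),
    fun k hk => h.natDegree k (by omega)⟩

theorem Regular.degree_lt {s : ℕ} (h : Regular f g hf G s) {P : LRing K}
    (hP : P ∈ Submodule.span K (Std I G (ratioSeq f g hf G) s)) :
    P.degree < dimSeq f g hf G s :=
  degree_lt_of_mem_span (Std_degree_lt dimSeq_zero s h.monic h.natDegree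
    fun _ _ => dimSeq_succ _) hP

theorem Regular.mem_span {s : ℕ} (h : Regular f g hf G s) {P : LRing K}
    (hP : P.degree < dimSeq f g hf G s) :
    P ∈ Submodule.span K (Std Set.univ G (ratioSeq f g hf G) s) :=
  mem_span_Std (B := ⊤) (fun x _ => C_mem_span x) dimSeq_zero s h.monic h.natDegree
    (fun _ _ => dimSeq_succ _) (fun _ _ => coeffIn_top _) P (coeffIn_top _) hP

theorem Regular.mem_span_nonneg {s : ℕ} (h : Regular f g hf G s)
    (hG : ∀ k < s, CoeffIn (polyPart K) (G k)) {P : LRing K} (hPc : CoeffIn (polyPart K) P)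
    (hP : P.degree < dimSeq f g hf G s) :
    P ∈ Submodule.span K (Std {i | 0 ≤ i} G (ratioSeq f g hf G) s) :=
  mem_span_Std (fun _ hx => C_mem_span_of_mem_polyPart hx) dimSeq_zero s h.monic h.natDegree
    (fun _ _ => dimSeq_succ _) hG P hPc hP

/-- The dichotomy used throughout: low g-degree forces divisibility by d_{s-1}, in contrast to g_s
itself for s > 0. -/
theorem Regular.exists_vdeg {s : ℕ} (h : Regular f g hf G s) {P : LRing K}
    (hP : P.degree < dimSeq f g hf G s) (h0 : P ≠ 0) :
    ∃ N : ℤ, vdeg f g hf P = N ∧ (gcdSeq f g hf G s : ℤ) ∣ N :=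
  vdeg_of_mem_span_Std h.pos h.ne_zero (h.mem_span hP) h0

theorem Regular.toRat_ne_zero {s : ℕ} (h : Regular f g hf G s) {P : LRing K}
    (hP : P.degree < dimSeq f g hf G s) (h0 : P ≠ 0) : toRat f g hf P ≠ 0 := by
  obtain ⟨N, hN, -⟩ := h.exists_vdeg hP h0
  exact (vdeg_eq_coe.1 hN).1

end Numeration

/-! ### The minimal relation between f(z) and g(z) -/

section MinimalRelation

/-- Over an integrally closed domain the minimal polynomial of an integral element divides every
relation, not only the monic ones. -/
theorem exists_monic_minimal {R S : Type*} [CommRing R] [IsDomain R] [IsIntegrallyClosed R]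
    [CommRing S] [IsDomain S] (φ : R →+* S) (hφ : Function.Injective φ) {x : S}
    (hx : φ.IsIntegralElem x) :
    ∃ q : R[X], q.Monic ∧ q.eval₂ φ x = 0 ∧
      ∀ p : R[X], p ≠ 0 → p.eval₂ φ x = 0 → q.natDegree ≤ p.natDegree := by
  let _ := φ.toAlgebra
  have : FaithfulSMul R S := (faithfulSMul_iff_algebraMap_injective R S).2 hφ
  have hx' : IsIntegral R x := hx
  exact ⟨minpoly R x, minpoly.monic hx', minpoly.aeval R x, fun p hp0 hp =>
    natDegree_le_of_dvd (minpoly.isIntegrallyClosed_dvd hx' hp) hp0⟩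

variable {K : Type*} [Field K] {f g : K[X]} {hf : f ≠ 0}

/-- K[z] is integral over K[f] because z is a root of f(Y) - f, made monic by dividing by the
leading coefficient of f. -/
theorem isIntegralElem_aeval (hn : 0 < f.natDegree) (p : K[X]) :
    ((aeval f : K[X] →ₐ[K] K[X]) : K[X] →+* K[X]).IsIntegralElem p := by
  set φ : K[X] →+* K[X] := ((aeval f : K[X] →ₐ[K] K[X]) : K[X] →+* K[X]) with hφ
  have hC : ∀ c : K, φ (C c) = C c := fun c => by simp [hφ]
  have hX : φ.IsIntegralElem X := by
    have hf : f ≠ 0 := by rintro rfl; simp at hn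
    have hfd : (f.map (C : K →+* K[X])).natDegree = f.natDegree :=
      natDegree_map_eq_of_injective C_injective f
    have hd : (f.map (C : K →+* K[X]) - C X).natDegree = f.natDegree := by
      rw [natDegree_sub_C, hfd]
    refine ⟨C (C f.leadingCoeff⁻¹) * (f.map C - C X), ?_, ?_⟩
    · refine monic_of_natDegree_le_of_coeff_eq_one f.natDegree
        ((natDegree_C_mul_le _ _).trans hd.le) ?_
      rw [coeff_C_mul, coeff_sub, coeff_map, coeff_C, if_neg hn.ne', sub_zero, ← C_mul,
        coeff_natDegree, inv_mul_cancel₀ (leadingCoeff_ne_zero.2 hf), C_1]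
    · have h1 : φ X = f := by simp [hφ]
      have h2 : φ.comp C = C := RingHom.ext hC
      rw [eval₂_mul, eval₂_sub, eval₂_map, h2, eval₂_C, eval₂_C, h1, eval₂_C_X, sub_self, mul_zero]
  have hXpow : ∀ k : ℕ, φ.IsIntegralElem (X ^ k) := by
    intro k
    induction k with
    | zero => rw [pow_zero]; exact φ.isIntegralElem_one
    | succ k ih => rw [pow_succ]; exact ih.mul φ hX
  induction p using Polynomial.induction_on' with
  | add p q hp hq => exact hp.add φ hq
  | monomial k c =>
    rw [← C_mul_X_pow_eq_monomial, ← hC]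
    exact (φ.isIntegralElem_map).mul φ (hXpow k)

theorem toRat_map (q : K[X][X]) : toRat f g hf (q.map toLaurent) = algebraMap K[X] (RatFunc K)
    (q.eval₂ ((aeval f : K[X] →ₐ[K] K[X]) : K[X] →+* K[X]) g) := by
  have : (toRat f g hf).comp (mapRingHom toLaurent) = (algebraMap K[X] (RatFunc K)).comp
      (eval₂RingHom ((aeval f : K[X] →ₐ[K] K[X]) : K[X] →+* K[X]) g) := by
    refine ringHom_ext' (ringHom_ext' ?_ ?_) ?_
    · ext c
      simp [toRat]
    · simp [toRat]
    · simp [toRat]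
  exact RingHom.congr_fun this q

theorem coeffIn_map (q : K[X][X]) : CoeffIn (polyPart K) (q.map toLaurent) := fun k => by
  rw [coeff_map]
  exact ⟨_, rfl⟩

theorem exists_map_eq_mul_T (P : LRing K) :
    ∃ (N : ℕ) (q : K[X][X]), q.map toLaurent = C (LaurentPolynomial.T N) * P := by
  induction P using Polynomial.induction_on' with
  | add P Q hP hQ =>
    obtain ⟨N, p, hp⟩ := hP
    obtain ⟨M, q, hq⟩ := hQ
    refine ⟨N + M, C (X ^ M) * p + C (X ^ N) * q, ?_⟩
    rw [Polynomial.map_add, Polynomial.map_mul, Polynomial.map_mul, hp, hq, map_C, map_C,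
      toLaurent_X_pow, toLaurent_X_pow, Nat.cast_add, LaurentPolynomial.T_add, C_mul]
    ring
  | monomial k c =>
    obtain ⟨N, p, hp⟩ := LaurentPolynomial.exists_T_pow c
    refine ⟨N, monomial k p, ?_⟩
    rw [map_monomial, hp, C_mul_monomial, mul_comm]

/-- The monic polynomial relation of minimal degree between `f(z)` and `g(z)`. -/
theorem exists_minimal_relation (hn : 0 < f.natDegree) :
    ∃ Q : LRing K, Q.Monic ∧ CoeffIn (polyPart K) Q ∧ toRat f g hf Q = 0 ∧
      ∀ P : LRing K, P ≠ 0 → toRat f g hf P = 0 → Q.natDegree ≤ P.natDegree := by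
  have hinj : Function.Injective ((aeval f : K[X] →ₐ[K] K[X]) : K[X] →+* K[X]) := by
    refine (injective_iff_map_eq_zero _).2 fun p hp => ?_
    by_contra hp0
    have h1 : (p.comp f) = 0 := by
      rw [comp_eq_aeval]
      exact hp
    rcases comp_eq_zero_iff.1 h1 with h | ⟨-, h⟩
    · exact hp0 h
    · rw [h, natDegree_C] at hn
      exact lt_irrefl _ hn
  obtain ⟨q, hq, hq0, hmin⟩ := exists_monic_minimal _ hinj (isIntegralElem_aeval hn g)
  refine ⟨q.map toLaurent, hq.map _, coeffIn_map q, by rw [toRat_map, hq0, map_zero], ?_⟩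
  intro P hP hP0
  -- Multiplying by a power of the unit f clears the negative exponents and changes neither the
  -- g-degree nor the vanishing in K(z).
  obtain ⟨N, p, hp⟩ := exists_map_eq_mul_T P
  have hT : IsUnit (C (LaurentPolynomial.T N) : LRing K) :=
    isUnit_C.2 (LaurentPolynomial.isUnit_T _)
  have hp0 : p ≠ 0 := by
    rintro rfl
    rw [Polynomial.map_zero] at hp
    exact mul_ne_zero hT.ne_zero hP hp.symm
  have hpe : p.eval₂ ((aeval f : K[X] →ₐ[K] K[X]) : K[X] →+* K[X]) g = 0 := by
    have := toRat_map (f := f) (g := g) (hf := hf) p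
    rw [hp, map_mul, hP0, mul_zero] at this
    exact (map_eq_zero_iff _ (RatFunc.algebraMap_injective K)).1 this.symm
  have hd : p.natDegree = P.natDegree := by
    rw [← natDegree_map_eq_of_injective toLaurent_injective p, hp,
      natDegree_C_mul (LaurentPolynomial.isUnit_T _).ne_zero]
  rw [hq.natDegree_map, ← hd]
  exact hmin p hp0 hpe

/-- A dimension count: if there is no relation of degree at most `D` between `f(z)` and `g(z)`,
some polynomial in `f`, `g` of `g`-degree at most `D` has a `z`-degree not divisible by
`d = n / D`. -/
theorem exists_not_dvd_zdeg {D d : ℕ} (hd : 0 < d) (hDd : D * d = f.natDegree)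
    (hD : ∀ P : LRing K, P ≠ 0 → P.natDegree ≤ D → toRat f g hf P ≠ 0) :
    ∃ P : LRing K, P.natDegree ≤ D ∧ toRat f g hf P ≠ 0 ∧ ¬ (d : ℤ) ∣ zdeg f g hf P := by
  set m := g.natDegree with hm
  -- Chosen so that the (N+1)(D+1) unknown coefficients outnumber the ND + mD + 1 conditions imposed
  -- by `Ψ`.
  set N := m * D + 1 with hN
  set φ : K[X] →+* K[X] := ((aeval f : K[X] →ₐ[K] K[X]) : K[X] →+* K[X]) with hφ
  let v : Fin (N + 1) × Fin (D + 1) → K[X] := fun ij => f ^ (ij.1 : ℕ) * g ^ (ij.2 : ℕ)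
  -- An element of the kernel gives a polynomial in z with no term of exponent divisible by d,
  -- within its degree bound; so its degree is not divisible by d.
  let Ψ : (Fin (N + 1) × Fin (D + 1) → K) →ₗ[K] (Fin (N * D + m * D + 1) → K) :=
    LinearMap.pi fun k => (lcoeff K (d * k)).comp (Fintype.linearCombination K v)
  have hker : LinearMap.ker Ψ ≠ ⊥ := by
    refine LinearMap.ker_ne_bot_of_finrank_lt ?_
    rw [Module.finrank_fintype_fun_eq_card, Module.finrank_fintype_fun_eq_card]
    simp only [Fintype.card_fin, Fintype.card_prod]
    nlinarith
  obtain ⟨c, hc, hc0⟩ := (Submodule.ne_bot_iff _).1 hker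
  let q : K[X][X] := ∑ ij : Fin (N + 1) × Fin (D + 1), monomial ij.2 (monomial ij.1 (c ij))
  have hqc : ∀ i j, (q.coeff (j : Fin (D + 1))).coeff (i : Fin (N + 1)) = c (i, j) := by
    intro i j
    simp only [q, finsetSum_coeff, coeff_monomial]
    rw [Finset.sum_eq_single (i, j)]
    · simp
    · rintro ⟨i', j'⟩ - hne
      by_cases h : j' = j
      · have : i' ≠ i := fun h' => hne (by rw [h, h'])
        simp [h, coeff_monomial, Fin.val_inj, this]
      · simp [Fin.val_inj, h]
    · simp
  have hq0 : q ≠ 0 := by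
    intro h
    refine hc0 (funext fun ⟨i, j⟩ => ?_)
    rw [← hqc, h]
    simp
  have hqd : q.natDegree ≤ D := natDegree_sum_le_of_forall_le _ _ fun ij _ =>
    (natDegree_monomial_le _).trans (by omega)
  have hev : q.eval₂ φ g = Fintype.linearCombination K v c := by
    rw [Fintype.linearCombination_apply]
    simp only [q, eval₂_finsetSum, eval₂_monomial, v]
    refine Finset.sum_congr rfl fun ij _ => ?_
    rw [hφ, RingHom.coe_coe, aeval_monomial, ← C_eq_algebraMap, smul_eq_C_mul, mul_assoc]
  set P : LRing K := q.map toLaurent with hP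
  have hP0 : toRat f g hf P ≠ 0 := hD P
    ((Polynomial.map_ne_zero_iff toLaurent_injective).2 hq0)
    (natDegree_map_le.trans hqd)
  set r := q.eval₂ φ g with hr
  have hPr : toRat f g hf P = algebraMap K[X] (RatFunc K) r := toRat_map q
  have hr0 : r ≠ 0 := by
    intro h
    rw [hPr, h, map_zero] at hP0
    exact hP0 rfl
  have hrd : r.natDegree ≤ d * (N * D + m * D) := by
    rw [hev, Fintype.linearCombination_apply]
    refine natDegree_sum_le_of_forall_le _ _ fun ij _ => (natDegree_smul_le _ _).trans ?_
    refine natDegree_mul_le.trans ?_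
    refine (add_le_add natDegree_pow_le natDegree_pow_le).trans ?_
    have h1 : (ij.1 : ℕ) ≤ N := by omega
    have h2 : (ij.2 : ℕ) ≤ D := by omega
    calc (ij.1 : ℕ) * f.natDegree + (ij.2 : ℕ) * g.natDegree
        ≤ N * f.natDegree + D * m := by rw [hm]; gcongr
      _ = N * D * d + 1 * (D * m) := by rw [← hDd]; ring
      _ ≤ N * D * d + d * (D * m) := by gcongr; omega
      _ = d * (N * D + m * D) := by ring
  refine ⟨P, natDegree_map_le.trans hqd, hP0, ?_⟩
  rw [zdeg, hPr, RatFunc.intDegree_polynomial, Int.natCast_dvd_natCast]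
  rintro ⟨k, hk⟩
  have hk' : k < N * D + m * D + 1 := by
    rw [hk] at hrd
    have := Nat.le_of_mul_le_mul_left hrd hd
    omega
  have h := congrFun (LinearMap.mem_ker.1 hc) ⟨k, hk'⟩
  have h' : r.coeff (d * k) = 0 := by rw [hev]; exact h
  rw [← hk, coeff_natDegree, leadingCoeff_eq_zero] at h'
  exact hr0 h'

end MinimalRelation

/-! ### Feasibility and termination of the algorithm -/

section Runs

variable {K : Type*} [Field K] {f g : K[X]} {hf : f ≠ 0} {G : ℕ → LRing K}

theorem monic_sub {A : Type*} [CommRing A] [Nontrivial A] {P u : A[X]} {d : ℕ} (hP : P.Monic)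
    (hd : P.natDegree = d) (hu : u.degree < d) : (P - u).Monic ∧ (P - u).natDegree = d := by
  have hu' : u.degree < P.degree := by rwa [degree_eq_natDegree hP.ne_zero, hd]
  exact ⟨hP.sub_of_left hu', by
    rw [natDegree_eq_of_degree_eq (degree_sub_eq_left_of_degree_lt hu'), hd]⟩

theorem degree_sub_lt_of_monic {A : Type*} [CommRing A] [Nontrivial A] {P Q : A[X]} {d : ℕ}
    (hP : P.Monic) (hPd : P.natDegree = d) (hQ : Q.Monic) (hQd : Q.natDegree = d) :
    (P - Q).degree < d := by
  have h := degree_sub_lt_left (p := P) (q := Q) (by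
    rw [degree_eq_natDegree hP.ne_zero, degree_eq_natDegree hQ.ne_zero, hPd, hQd]) hP.ne_zero
    (by rw [hP.leadingCoeff, hQ.leadingCoeff])
  rwa [degree_eq_natDegree hP.ne_zero, hPd] at h

theorem reduces_iff {t : ℕ} (hG : ∀ k < t, toRat f g hf (G k) ≠ 0) {h h' : LRing K} :
    Reduces f g hf G t h h' ↔ toRat f g hf h ≠ 0 ∧
      ∃ M ∈ Std Set.univ G (ratioSeq f g hf G) t, ∃ c : K, vdeg f g hf M = vdeg f g hf h ∧
        h' = h - c • M ∧ vdeg f g hf h' < vdeg f g hf h := by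
  have hlt : toRat f g hf h ≠ 0 → ((toRat f g hf h' = 0 ∨ zdeg f g hf h' < zdeg f g hf h) ↔
      vdeg f g hf h' < vdeg f g hf h) := by
    intro h0
    rw [vdeg_of_ne h0]
    by_cases h1 : toRat f g hf h' = 0
    · simp [h1, vdeg_eq_bot.2 h1]
    · simp [h1, vdeg_of_ne h1]
  constructor
  · rintro ⟨h0, M, c, hM, hd, he, hl⟩
    rw [isStandard_iff] at hM
    refine ⟨h0, M, hM, c, ?_, he, (hlt h0).1 hl⟩
    rw [vdeg_of_ne h0, vdeg_of_ne (Std_toRat_ne_zero t hG M hM), hd]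
  · rintro ⟨h0, M, hM, c, hd, he, hl⟩
    refine ⟨h0, M, c, isStandard_iff.2 hM, ?_, he, (hlt h0).2 hl⟩
    rwa [vdeg_of_ne h0, vdeg_of_ne (Std_toRat_ne_zero t hG M hM), WithBot.coe_inj] at hd

theorem exists_reduces (hn : 0 < f.natDegree) {t : ℕ} (hG : ∀ k < t, toRat f g hf (G k) ≠ 0)
    {h : LRing K} (h0 : toRat f g hf h ≠ 0) (hd : (gcdSeq f g hf G t : ℤ) ∣ zdeg f g hf h) :
    ∃ h', Reduces f g hf G t h h' := by
  obtain ⟨M, hM, hMd⟩ := exists_Std_vdeg_eq hn t hG _ hd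
  rw [← vdeg_of_ne h0] at hMd
  obtain ⟨c, hc⟩ := exists_vdeg_sub_smul_lt hMd.symm h0
  exact ⟨_, (reduces_iff hG).2 ⟨h0, M, hM, c, hMd, rfl, hc⟩⟩

theorem sub_mem_span_of_reduces {t : ℕ} (hG : ∀ k < t, toRat f g hf (G k) ≠ 0) {h h' : LRing K}
    (hr : Reduces f g hf G t h h') :
    h - h' ∈ Submodule.span K {M ∈ Std Set.univ G (ratioSeq f g hf G) t |
      vdeg f g hf M ≤ vdeg f g hf h ∧ vdeg f g hf h' < vdeg f g hf M} := by
  obtain ⟨h0, M, hM, c, hd, rfl, hl⟩ := (reduces_iff hG).1 hr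
  rw [sub_sub_cancel]
  exact Submodule.smul_mem _ _ (Submodule.subset_span ⟨hM, hd.le, hd ▸ hl⟩)

theorem vdeg_lt_of_reduces {t : ℕ} (hG : ∀ k < t, toRat f g hf (G k) ≠ 0) {h h' : LRing K}
    (hr : Reduces f g hf G t h h') : vdeg f g hf h' < vdeg f g hf h := by
  obtain ⟨h0, M, hM, c, hd, -, hl⟩ := (reduces_iff hG).1 hr
  exact hl

/-- The strict lower bound on the subtracted monomials later identifies them with the top part of
another expansion. -/
theorem sub_mem_span_of_reflTransGen {t : ℕ} (hG : ∀ k < t, toRat f g hf (G k) ≠ 0)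
    {h h' : LRing K} (hr : Relation.ReflTransGen (Reduces f g hf G t) h h') :
    vdeg f g hf h' ≤ vdeg f g hf h ∧
    h - h' ∈ Submodule.span K {M ∈ Std Set.univ G (ratioSeq f g hf G) t |
      vdeg f g hf M ≤ vdeg f g hf h ∧ vdeg f g hf h' < vdeg f g hf M} := by
  induction hr with
  | refl => exact ⟨le_rfl, by rw [sub_self]; exact Submodule.zero_mem _⟩
  | @tail b c _ hbc ih =>
    obtain ⟨ih1, ih2⟩ := ih
    have hlt := vdeg_lt_of_reduces hG hbc
    refine ⟨hlt.le.trans ih1, ?_⟩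
    rw [← sub_add_sub_cancel h b c]
    refine Submodule.add_mem _ (Submodule.span_mono ?_ ih2)
      (Submodule.span_mono ?_ (sub_mem_span_of_reduces hG hbc))
    · rintro M ⟨hM, h1, h2⟩
      exact ⟨hM, h1, hlt.trans h2⟩
    · rintro M ⟨hM, h1, h2⟩
      exact ⟨hM, h1.trans ih1, h2⟩

/-- The shape of the element produced by one step of the algorithm. -/
theorem step_spec (hn : 0 < f.natDegree) {s : ℕ} (hG : ∀ k < s + 1, toRat f g hf (G k) ≠ 0)
    (hs : IsStep f g hf G s) :
    vdeg f g hf (G (s + 1)) < ((ratioSeq f g hf G s * zdeg f g hf (G s) : ℤ) : WithBot ℤ) ∧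
    G s ^ ratioSeq f g hf G s - G (s + 1) ∈
      Submodule.span K {M ∈ Std Set.univ G (ratioSeq f g hf G) (s + 1) |
        vdeg f g hf M ≤ ((ratioSeq f g hf G s * zdeg f g hf (G s) : ℤ) : WithBot ℤ) ∧
        vdeg f g hf (G (s + 1)) < vdeg f g hf M} := by
  obtain ⟨h, h1, h2, -⟩ := hs
  have hG' := fun k (hk : k < s) => hG k (by omega)
  have hpow := vdeg_pow (vdeg_of_ne (hG s (by omega))) (ratioSeq f g hf G s)
  have hlt := vdeg_lt_of_reduces hG' h1
  have hm := sub_mem_span_of_reduces hG' h1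
  obtain ⟨hle, hm2⟩ := sub_mem_span_of_reflTransGen hG h2
  rw [hpow] at hlt hm
  refine ⟨hle.trans_lt hlt, ?_⟩
  rw [← sub_add_sub_cancel _ h]
  refine Submodule.add_mem _ (Submodule.span_mono ?_ hm) (Submodule.span_mono ?_ hm2)
  · rintro M ⟨hM, h1, h2⟩
    exact ⟨Std_subset_succ (ratioSeq_pos hn s) hM, h1, hle.trans_lt h2⟩
  · rintro M ⟨hM, h1, h2⟩
    exact ⟨hM, h1.trans hlt.le, h2⟩

theorem IsRun.mono {s t : ℕ} (h : IsRun f g hf G t) (hst : s ≤ t) : IsRun f g hf G s :=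
  ⟨h.1, fun i hi => h.2 i (by omega)⟩

/-- g_s^{a_s} is monic of g-degree a_s D_s = D_{s+1}, and all subtracted monomials have smaller
g-degree. -/
theorem IsRun.regular (hn : 0 < f.natDegree) {s : ℕ} (h : IsRun f g hf G s) :
    Regular f g hf G s ∧ (G s).Monic ∧ (G s).natDegree = dimSeq f g hf G s := by
  induction s with
  | zero =>
    refine ⟨⟨hn, fun k hk => by omega, fun k hk => by omega, fun k hk => by omega⟩, ?_⟩
    rw [h.1, dimSeq_zero]
    exact ⟨monic_X, natDegree_X⟩
  | succ s ih =>
    obtain ⟨hreg, hm, hd⟩ := ih (h.mono (by omega))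
    obtain ⟨h0, hs⟩ := h.2 s (by omega)
    have hreg' : Regular f g hf G (s + 1) := by
      refine ⟨hn, fun k hk => (h.2 k hk).1, fun k hk => ?_, fun k hk => ?_⟩
      · rcases Nat.lt_succ_iff_lt_or_eq.1 hk with h | rfl
        exacts [hreg.monic k h, hm]
      · rcases Nat.lt_succ_iff_lt_or_eq.1 hk with h | rfl
        exacts [hreg.natDegree k h, hd]
    obtain ⟨-, hmem⟩ := step_spec hn hreg'.ne_zero hs
    have hlt := hreg'.degree_lt (Submodule.span_mono (fun M hM => hM.1) hmem)
    have := monic_sub (hm.pow (ratioSeq f g hf G s)) (by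
      rw [hm.natDegree_pow, hd, ← dimSeq_succ]) hlt
    rw [sub_sub_cancel] at this
    exact ⟨hreg', this⟩

/-- `Q` is invisible in K(z), so reducing Q + u means removing the leading term of u; the finite set
of monomials shrinks each time. -/
theorem reflTransGen_of_mem_span {t : ℕ} (hreg : Regular f g hf G t) {Q : LRing K}
    (hQ : toRat f g hf Q = 0) : ∀ (A : Finset (LRing K)),
    (A : Set (LRing K)) ⊆ Std Set.univ G (ratioSeq f g hf G) t →
    ∀ u ∈ Submodule.span K (A : Set (LRing K)),
      Relation.ReflTransGen (Reduces f g hf G t) (Q + u) Q := by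
  classical
  intro A
  induction A using Finset.strongInduction with
  | H A ih =>
    intro hA u hu
    by_cases hu0 : u = 0
    · rw [hu0, add_zero]
    have hA0 : ∀ M ∈ (A : Set (LRing K)), toRat f g hf M ≠ 0 := fun M hM =>
      Std_toRat_ne_zero t hreg.ne_zero M (hA hM)
    obtain ⟨M, hM, c, hc, hd, hmem⟩ := exists_leading_term hA0
      ((Std_injOn hreg.pos t hreg.ne_zero).mono hA) hu hu0
    have hlt := vdeg_lt_of_mem_span (bot_lt_iff_ne_bot.2 fun h => hA0 M hM (vdeg_eq_bot.1 h))
      (fun M' hM' => hM'.2) hmem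
    have hv : ∀ x : LRing K, vdeg f g hf (Q + x) = vdeg f g hf x := by
      intro x
      rw [vdeg, vdeg, zdeg, zdeg, map_add, hQ, zero_add]
    refine Relation.ReflTransGen.head (b := Q + (u - c • M)) ?_ ?_
    · rw [reduces_iff hreg.ne_zero, hv, hv, hd]
      refine ⟨?_, M, hA hM, c, rfl, by ring, hlt⟩
      rw [map_add, hQ, zero_add]
      intro h
      rw [vdeg_eq_bot.2 h] at hd
      exact hA0 M hM (vdeg_eq_bot.1 hd.symm)
    · refine ih (A.erase M) (Finset.erase_ssubset hM)
        (fun x hx => hA (Finset.mem_of_mem_erase hx)) _ (Submodule.span_mono ?_ hmem)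
      rintro x ⟨hx, hlt⟩
      exact Finset.mem_erase.2 ⟨fun h => lt_irrefl _ (h ▸ hlt), hx⟩

theorem Regular.monic_of_reduces {t : ℕ} (hreg : Regular f g hf G t) {h h' : LRing K}
    (hh : h.Monic) (hd : h.natDegree = dimSeq f g hf G t) (hr : Reduces f g hf G t h h') :
    h'.Monic ∧ h'.natDegree = dimSeq f g hf G t := by
  have := monic_sub hh hd (hreg.degree_lt (Submodule.span_mono (fun M hM => hM.1)
    (sub_mem_span_of_reduces hreg.ne_zero hr)))
  rwa [sub_sub_cancel] at this

/-- If there is no relation of degree at most `a₀ ⋯ a_{t-1}`, the monic polynomials of that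
degree whose `z`-degree is divisible by `d_{t-1}` have bounded `z`-degree. -/
theorem Regular.exists_lower_bound {t : ℕ} (hreg : Regular f g hf G t)
    (hD : ∀ P : LRing K, P ≠ 0 → P.natDegree ≤ dimSeq f g hf G t → toRat f g hf P ≠ 0) :
    ∃ b : ℤ, ∀ h : LRing K, h.Monic → h.natDegree = dimSeq f g hf G t →
      (gcdSeq f g hf G t : ℤ) ∣ zdeg f g hf h → b < zdeg f g hf h := by
  obtain ⟨w, hwd, hw0, hwn⟩ := exists_not_dvd_zdeg (gcdSeq_pos hreg.pos t) (dimSeq_mul_gcdSeq t) hD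
  set D := dimSeq f g hf G t with hDdef
  set d := gcdSeq f g hf G t with hddef
  have hlow : ∀ P : LRing K, P.degree < D → vdeg f g hf P ≠ vdeg f g hf w := by
    intro P hP h
    have hP0 : P ≠ 0 := by
      rintro rfl
      rw [vdeg_zero, eq_comm, vdeg_eq_bot] at h
      exact hw0 h
    obtain ⟨N, hN, hd⟩ := hreg.exists_vdeg hP hP0
    rw [hN, vdeg_of_ne hw0, WithBot.coe_inj] at h
    exact hwn (h ▸ hd)
  -- `w` must have g-degree exactly D, as its z-degree is not divisible by d. If α h had smaller
  -- z-degree than w, then w - α h would have g-degree below D but the z-degree of w, which is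
  -- impossible.
  set α := w.coeff D with hα
  have hα0 : C α ≠ 0 := by
    intro h
    rw [C_eq_zero] at h
    refine hlow w ((degree_lt_iff_coeff_zero _ _).2 fun k hk => ?_) rfl
    rcases eq_or_lt_of_le hk with rfl | hk
    · exact h
    · exact coeff_eq_zero_of_natDegree_lt (hwd.trans_lt hk)
  obtain ⟨e, he, hed⟩ := vdeg_of_mem_span_Std hreg.pos (G := G) (g := g) (hf := hf) (t := 0)
    (fun k hk => by omega) (C_mem_span α) hα0
  have hed' : (d : ℤ) ∣ e := (Int.natCast_dvd_natCast.2 (gcdSeq_dvd (Nat.zero_le t))).trans hed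
  refine ⟨zdeg f g hf w - e, fun h hm hd hdvd => ?_⟩
  have h0 : toRat f g hf h ≠ 0 := hD h hm.ne_zero hd.le
  have hx : vdeg f g hf (C α * h) = (e + zdeg f g hf h : ℤ) := by
    rw [vdeg_mul, he, vdeg_of_ne h0, ← WithBot.coe_add]
  have hy : (w - C α * h).degree < D := by
    refine (degree_lt_iff_coeff_zero _ _).2 fun k hk => ?_
    rcases eq_or_lt_of_le hk with rfl | hk
    · rw [coeff_sub, coeff_C_mul, ← hd, hm.coeff_natDegree, mul_one, hα, hd, sub_self]
    · exact coeff_eq_zero_of_natDegree_lt (((natDegree_sub_le _ _).trans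
        (max_le hwd ((natDegree_C_mul_le _ _).trans hd.le))).trans_lt hk)
  by_contra hlt
  have hne : e + zdeg f g hf h ≠ zdeg f g hf w := fun h' => hwn (h' ▸ dvd_add hed' hdvd)
  refine hlow _ hy (vdeg_sub_eq_left ?_)
  rw [hx, vdeg_of_ne hw0, WithBot.coe_lt_coe]
  omega

/-- The reductions in one step of the algorithm end after finitely many steps. -/
theorem Regular.exists_reflTransGen {t : ℕ} (hreg : Regular f g hf G t) {h : LRing K}
    (hm : h.Monic) (hd : h.natDegree = dimSeq f g hf G t) :
    ∃ P, Relation.ReflTransGen (Reduces f g hf G t) h P ∧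
      (toRat f g hf P = 0 ∨ ¬ (gcdSeq f g hf G t : ℤ) ∣ zdeg f g hf P) := by
  by_cases hQ : ∃ Q : LRing K, Q.Monic ∧ Q.natDegree = dimSeq f g hf G t ∧ toRat f g hf Q = 0
  · obtain ⟨Q, hQm, hQd, hQ0⟩ := hQ
    have hu := hreg.mem_span (degree_sub_lt_of_monic hm hd hQm hQd)
    obtain ⟨A, hA, hu'⟩ := Submodule.mem_span_finite_of_mem_span hu
    have := reflTransGen_of_mem_span hreg hQ0 A hA _ hu'
    rw [add_sub_cancel] at this
    exact ⟨Q, this, Or.inl hQ0⟩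
  · have hD : ∀ P : LRing K, P ≠ 0 → P.natDegree ≤ dimSeq f g hf G t → toRat f g hf P ≠ 0 := by
      intro P hP hPd hP0
      obtain ⟨Q, hQm, -, hQ0, hmin⟩ := exists_minimal_relation (g := g) (hf := hf) hreg.pos
      rcases eq_or_lt_of_le ((hmin P hP hP0).trans hPd) with h | h
      · exact hQ ⟨Q, hQm, h, hQ0⟩
      · exact hreg.toRat_ne_zero ((natDegree_lt_iff_degree_lt hQm.ne_zero).1 h) hQm.ne_zero hQ0
    obtain ⟨b, hb⟩ := hreg.exists_lower_bound hD
    have main : ∀ k : ℕ, ∀ h : LRing K, h.Monic → h.natDegree = dimSeq f g hf G t →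
        zdeg f g hf h ≤ b + k → ∃ P, Relation.ReflTransGen (Reduces f g hf G t) h P ∧
          (toRat f g hf P = 0 ∨ ¬ (gcdSeq f g hf G t : ℤ) ∣ zdeg f g hf P) := by
      intro k
      induction k with
      | zero =>
        intro h hm hd hle
        refine ⟨h, .refl, Or.inr fun hdvd => ?_⟩
        have := hb h hm hd hdvd
        simp at hle
        omega
      | succ k ih =>
        intro h hm hd hle
        by_cases hdvd : (gcdSeq f g hf G t : ℤ) ∣ zdeg f g hf h
        · have h0 := hD h hm.ne_zero hd.le
          obtain ⟨h', hr⟩ := exists_reduces hreg.pos hreg.ne_zero h0 hdvd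
          obtain ⟨hm', hd'⟩ := hreg.monic_of_reduces hm hd hr
          have hlt := vdeg_lt_of_reduces hreg.ne_zero hr
          rw [vdeg_of_ne h0, vdeg_of_ne (hD h' hm'.ne_zero hd'.le), WithBot.coe_lt_coe] at hlt
          obtain ⟨P, hP, hP'⟩ := ih h' hm' hd' (by push_cast at hle; omega)
          exact ⟨P, hP.head hr, hP'⟩
        · exact ⟨h, .refl, Or.inr hdvd⟩
    exact main (zdeg f g hf h - b).toNat h hm hd (by omega)

theorem Regular.exists_step {s : ℕ} (hreg : Regular f g hf G (s + 1)) :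
    ∃ P h : LRing K, Reduces f g hf G s (G s ^ ratioSeq f g hf G s) h ∧
      Relation.ReflTransGen (Reduces f g hf G (s + 1)) h P ∧
      (toRat f g hf P = 0 ∨ ¬ (gcdSeq f g hf G (s + 1) : ℤ) ∣ zdeg f g hf P) := by
  have h0 := hreg.ne_zero s (by omega)
  have hpow := vdeg_eq_coe.1 (vdeg_pow (vdeg_of_ne h0) (ratioSeq f g hf G s))
  -- The first reduction is possible since a_s m_s is a multiple of a_s d_s = d_{s-1}.
  obtain ⟨h, hr⟩ := exists_reduces hreg.pos (hreg.mono (Nat.le_succ s)).ne_zero hpow.1 (by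
    rw [hpow.2, ← ratioSeq_mul, Nat.cast_mul]
    exact mul_dvd_mul_left _ (gcdSeq_succ_dvd_zdeg s))
  have hm : (G s ^ ratioSeq f g hf G s).Monic := (hreg.monic s (by omega)).pow _
  have hd : (G s ^ ratioSeq f g hf G s).natDegree = dimSeq f g hf G (s + 1) := by
    rw [(hreg.monic s (by omega)).natDegree_pow, hreg.natDegree s (by omega), dimSeq_succ]
  have := monic_sub hm hd (hreg.degree_lt (Submodule.span_mono
    (fun M hM => Std_subset_succ (ratioSeq_pos hreg.pos s) hM.1)
    (sub_mem_span_of_reduces (hreg.mono (Nat.le_succ s)).ne_zero hr)))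
  rw [sub_sub_cancel] at this
  obtain ⟨P, hP, hP'⟩ := hreg.exists_reflTransGen this.1 this.2
  exact ⟨P, h, hr, hP, hP'⟩

section Congr

variable {G' : ℕ → LRing K}

/-- Everything in a run depends only on an initial segment of `G`, so a run may be extended by
updating one value. -/
theorem gcdSeq_congr : ∀ k, (∀ i < k, G i = G' i) → gcdSeq f g hf G k = gcdSeq f g hf G' k
  | 0, _ => rfl
  | k + 1, h => by
    rw [gcdSeq, gcdSeq, gcdSeq_congr k fun i hi => h i (by omega), h k (by omega)]

theorem ratioSeq_congr {k : ℕ} (h : ∀ i ≤ k, G i = G' i) :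
    ratioSeq f g hf G k = ratioSeq f g hf G' k := by
  rw [ratioSeq, ratioSeq, gcdSeq_congr k fun i hi => h i hi.le,
    gcdSeq_congr (k + 1) fun i hi => h i (by omega)]

theorem reduces_congr {t : ℕ} (h : ∀ i < t, G i = G' i) :
    Reduces f g hf G t = Reduces f g hf G' t := by
  ext x y
  simp only [Reduces, isStandard_iff]
  rw [Std_congr t h fun k hk => ratioSeq_congr fun i hi => h i (by omega)]

theorem isStep_congr {s : ℕ} (h : ∀ i ≤ s + 1, G i = G' i) :
    IsStep f g hf G s ↔ IsStep f g hf G' s := by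
  rw [IsStep, IsStep, reduces_congr fun i hi => h i (by omega),
    reduces_congr (t := s + 1) fun i hi => h i (by omega), h s (by omega), h (s + 1) (by omega),
    ratioSeq_congr fun i hi => h i (by omega), gcdSeq_congr (s + 1) fun i hi => h i (by omega)]

theorem isRun_congr {s : ℕ} (h : ∀ i ≤ s, G i = G' i) :
    IsRun f g hf G s ↔ IsRun f g hf G' s := by
  rw [IsRun, IsRun, h 0 (by omega)]
  refine and_congr_right fun _ => forall₂_congr fun i hi => ?_
  rw [h i hi.le, isStep_congr fun k hk => h k (by omega)]

end Congr

theorem IsRun.not_dvd {s : ℕ} (h : IsRun f g hf G s) (hs : 0 < s)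
    (h0 : toRat f g hf (G s) ≠ 0) : ¬ (gcdSeq f g hf G s : ℤ) ∣ zdeg f g hf (G s) := by
  obtain ⟨s, rfl⟩ := Nat.exists_eq_succ_of_ne_zero hs.ne'
  obtain ⟨-, -, -, -, h3⟩ := h.2 s (by omega)
  exact h3.resolve_left h0

/-- Every run of the algorithm extends to a complete one. -/
theorem IsRun.exists_complete (hn : 0 < f.natDegree) {s : ℕ} (h : IsRun f g hf G s) :
    ∃ (r : ℕ) (G' : ℕ → LRing K), s ≤ r ∧ (∀ i ≤ s, G' i = G i) ∧ IsRun f g hf G' r ∧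
      toRat f g hf (G' r) = 0 := by
  -- The gcd drops strictly except possibly at the first step, where n may divide m; the summand 1
  -- at s = 0 pays for that step.
  induction hk : gcdSeq f g hf G s + (if s = 0 then 1 else 0) using Nat.strong_induction_on
    generalizing s G with
  | _ k ih =>
    by_cases h0 : toRat f g hf (G s) = 0
    · exact ⟨s, G, le_rfl, fun _ _ => rfl, h, h0⟩
    obtain ⟨hreg, hm, hd⟩ := h.regular hn
    have hreg' : Regular f g hf G (s + 1) := by
      refine ⟨hn, fun k hk => ?_, fun k hk => ?_, fun k hk => ?_⟩ <;>
        rcases Nat.lt_succ_iff_lt_or_eq.1 hk with h | rfl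
      exacts [hreg.ne_zero k h, h0, hreg.monic k h, hm, hreg.natDegree k h, hd]
    obtain ⟨P, h1, hr, hP, hP'⟩ := hreg'.exists_step
    set G₁ := Function.update G (s + 1) P with hG₁
    have hagree : ∀ i ≤ s, G i = G₁ i := fun i hi => by
      rw [hG₁, Function.update_of_ne (by omega)]
    have hP1 : G₁ (s + 1) = P := by rw [hG₁, Function.update_self]
    have hrun : IsRun f g hf G₁ (s + 1) := by
      have hold := (isRun_congr hagree).1 h
      refine ⟨hold.1, fun i hi => ?_⟩
      rcases Nat.lt_succ_iff_lt_or_eq.1 hi with hi | rfl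
      · exact hold.2 i hi
      refine ⟨by rwa [← hagree i le_rfl], h1, ?_⟩
      rw [hP1, ← reduces_congr fun k hk => hagree k hk.le,
        ← reduces_congr (t := i + 1) fun k hk => hagree k (by omega), ← hagree i le_rfl,
        ← ratioSeq_congr hagree, ← gcdSeq_congr (i + 1) fun k hk => hagree k (by omega)]
      exact ⟨hr, hP, hP'⟩
    have hlt : gcdSeq f g hf G₁ (s + 1) + (if s + 1 = 0 then 1 else 0) < k := by
      rw [← gcdSeq_congr (s + 1) fun k hk => hagree k (by omega), ← hk, if_neg (by omega)]
      have hle := Nat.le_of_dvd (gcdSeq_pos hn s) (gcdSeq_succ_dvd (f := f) (g := g) (hf := hf)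
        (G := G) s)
      by_cases hs : s = 0
      · rw [if_pos hs]
        omega
      · rw [if_neg hs]
        refine lt_of_le_of_ne (by omega) fun heq => ?_
        refine h.not_dvd (by omega) h0 ?_
        have := gcdSeq_succ_dvd_zdeg (f := f) (g := g) (hf := hf) (G := G) s
        rwa [show gcdSeq f g hf G (s + 1) = gcdSeq f g hf G s by omega] at this
    obtain ⟨r, G', hr, hG', hrun', h0'⟩ := ih _ hlt hrun rfl
    exact ⟨r, G', by omega, fun i hi => by rw [hG' i (by omega), ← hagree i hi], hrun', h0'⟩

/-- The last element of a complete run is a polynomial in `f` and `g`. -/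
theorem IsRun.coeffIn_last (hn : 0 < f.natDegree) {r : ℕ} (h : IsRun f g hf G r)
    (h0 : toRat f g hf (G r) = 0) : CoeffIn (polyPart K) (G r) := by
  obtain ⟨hreg, hm, hd⟩ := h.regular hn
  obtain ⟨Q, hQm, hQc, hQ0, hmin⟩ := exists_minimal_relation (g := g) (hf := hf) hn
  have hQd : Q.natDegree = dimSeq f g hf G r := by
    refine le_antisymm (hd ▸ hmin _ hm.ne_zero h0) (not_lt.1 fun hlt => ?_)
    exact hreg.toRat_ne_zero ((natDegree_lt_iff_degree_lt hQm.ne_zero).1 hlt) hQm.ne_zero hQ0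
  -- Both are monic of g-degree D_r and vanish in K(z); their difference has lower g-degree and
  -- vanishes as well.
  have : G r - Q = 0 := by
    by_contra hne
    exact hreg.toRat_ne_zero (degree_sub_lt_of_monic hm hd hQm hQd) hne
      (by rw [map_sub, h0, hQ0, sub_self])
  rwa [sub_eq_zero.1 this]

end Runs

/-! ### The filtration by powers of H and the approximate root -/

section Filtration

variable {K : Type*} [Field K] {f g : K[X]} {hf : f ≠ 0} {G : ℕ → LRing K}

/-- The filtration of `L` attached to the expansions in powers of `H`, where `H` has weight `m`. -/
noncomputable def Filt (f g : K[X]) (hf : f ≠ 0) (H : LRing K) (D : ℕ) (m b : ℤ) :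
    Submodule K (LRing K) :=
  Submodule.span K {P | ∃ (c : LRing K) (i : ℕ), c.degree < D ∧
    vdeg f g hf c ≤ ((b - i * m : ℤ) : WithBot ℤ) ∧ P = c * H ^ i}

variable {H : LRing K} {D : ℕ} {m b b' : ℤ}

theorem Filt_mono (h : b ≤ b') : Filt f g hf H D m b ≤ Filt f g hf H D m b' := by
  refine Submodule.span_mono ?_
  rintro _ ⟨c, i, hc, hv, rfl⟩
  exact ⟨c, i, hc, hv.trans (WithBot.coe_le_coe.2 (by omega)), rfl⟩

theorem mem_Filt {c : LRing K} {i : ℕ} (hc : c.degree < D)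
    (hv : vdeg f g hf c ≤ ((b - i * m : ℤ) : WithBot ℤ)) : c * H ^ i ∈ Filt f g hf H D m b :=
  Submodule.subset_span ⟨c, i, hc, hv, rfl⟩

theorem mem_Filt_of_degree_lt {c : LRing K} (hc : c.degree < D)
    (hv : vdeg f g hf c ≤ (b : WithBot ℤ)) : c ∈ Filt f g hf H D m b := by
  have := mem_Filt (f := f) (g := g) (hf := hf) (H := H) (D := D) (m := m) (b := b) (i := 0) hc
    (by simpa using hv)
  rwa [pow_zero, mul_one] at this

theorem pow_mem_Filt_self (hD : 0 < D) (e : ℕ) : H ^ e ∈ Filt f g hf H D m (e * m) := by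
  have := mem_Filt (f := f) (g := g) (hf := hf) (H := H) (D := D) (m := m) (b := e * m) (i := e)
    (c := 1) (by rw [degree_one]; exact_mod_cast hD) (by rw [vdeg_one, sub_self])
  rwa [one_mul] at this

variable {s : ℕ}

/-- The degree of r is divisible by d_{s-1} and that of q H is not, so the two terms cannot cancel.
-/
theorem Regular.vdeg_mod_div (hreg : Regular f g hf G s) {q r : LRing K}
    (hm : vdeg f g hf H = m) (hmd : ¬ (gcdSeq f g hf G s : ℤ) ∣ m)
    (hq : q.degree < dimSeq f g hf G s) (hr : r.degree < dimSeq f g hf G s) :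
    vdeg f g hf r ≤ vdeg f g hf (r + q * H) ∧
      vdeg f g hf (q * H) ≤ vdeg f g hf (r + q * H) := by
  by_cases hr0 : r = 0
  · rw [hr0, vdeg_zero, zero_add]
    exact ⟨bot_le, le_rfl⟩
  by_cases hq0 : q = 0
  · rw [hq0, zero_mul, vdeg_zero, add_zero]
    exact ⟨le_rfl, bot_le⟩
  obtain ⟨N, hN, hdN⟩ := hreg.exists_vdeg hr hr0
  obtain ⟨N', hN', hdN'⟩ := hreg.exists_vdeg hq hq0
  have hqH : vdeg f g hf (q * H) = (N' + m : ℤ) := by rw [vdeg_mul, hN', hm, WithBot.coe_add]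
  rcases lt_trichotomy N (N' + m) with h | h | h
  · have hlt : vdeg f g hf r < vdeg f g hf (q * H) := by
      rw [hqH, hN]; exact WithBot.coe_lt_coe.2 h
    rw [add_comm, vdeg_add_eq_left hlt]
    exact ⟨hlt.le, le_rfl⟩
  · refine absurd ?_ hmd
    rw [h] at hdN
    exact (dvd_add_right hdN').1 hdN
  · have hlt : vdeg f g hf (q * H) < vdeg f g hf r := by
      rw [hqH, hN]; exact WithBot.coe_lt_coe.2 h
    rw [vdeg_add_eq_left hlt]
    exact ⟨le_rfl, hlt.le⟩

/-- The product of two coefficients is divided once by H; since remainder and carry do not cancel,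
each respects the weight of the product. -/
theorem Regular.mul_mem_Filt (hreg : Regular f g hf G s) (hH : H.Monic)
    (hHd : H.natDegree = dimSeq f g hf G s) (hm : vdeg f g hf H = m)
    (hmd : ¬ (gcdSeq f g hf G s : ℤ) ∣ m) {P P' : LRing K}
    (hP : P ∈ Filt f g hf H (dimSeq f g hf G s) m b)
    (hP' : P' ∈ Filt f g hf H (dimSeq f g hf G s) m b') :
    P * P' ∈ Filt f g hf H (dimSeq f g hf G s) m (b + b') := by
  refine (?_ : Filt f g hf H (dimSeq f g hf G s) m b * Filt f g hf H (dimSeq f g hf G s) m b' ≤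
    Filt f g hf H (dimSeq f g hf G s) m (b + b')) (Submodule.mul_mem_mul hP hP')
  rw [Filt, Filt, Submodule.span_mul_span, Submodule.span_le]
  rintro _ ⟨_, ⟨c, i, hc, hv, rfl⟩, _, ⟨c', i', hc', hv', rfl⟩, rfl⟩
  set r := (c * c') %ₘ H with hr
  set q := (c * c') /ₘ H with hq
  have hHdeg : H.degree = dimSeq f g hf G s := by rw [degree_eq_natDegree hH.ne_zero, hHd]
  have hrd : r.degree < dimSeq f g hf G s := by
    rw [← hHdeg]
    exact degree_modByMonic_lt _ hH
  have hqd : q.degree < dimSeq f g hf G s := by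
    by_cases hq0 : q = 0
    · rw [hq0, degree_zero]
      exact WithBot.bot_lt_coe _
    have hc0 : c ≠ 0 := by
      rintro rfl
      rw [hq, zero_mul, zero_divByMonic] at hq0
      exact hq0 rfl
    have hc0' : c' ≠ 0 := by
      rintro rfl
      rw [hq, mul_zero, zero_divByMonic] at hq0
      exact hq0 rfl
    rw [← natDegree_lt_iff_degree_lt hc0] at hc
    rw [← natDegree_lt_iff_degree_lt hc0'] at hc'
    rw [← natDegree_lt_iff_degree_lt hq0, hq, natDegree_divByMonic _ hH, natDegree_mul hc0 hc0',
      hHd]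
    omega
  have hsum : r + q * H = c * c' := by rw [mul_comm q]; exact modByMonic_add_div _ _
  obtain ⟨h1, h2⟩ := hreg.vdeg_mod_div hm hmd hqd hrd
  have hcc : vdeg f g hf (c * c') ≤ ((b + b' - (i + i' : ℕ) * m : ℤ) : WithBot ℤ) := by
    rw [vdeg_mul]
    refine (add_le_add hv hv').trans ?_
    rw [← WithBot.coe_add]
    refine WithBot.coe_le_coe.2 (le_of_eq ?_)
    push_cast
    ring
  rw [hsum] at h1 h2
  have hprod : (fun x1 x2 => x1 * x2) (c * H ^ i) (c' * H ^ i') =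
      r * H ^ (i + i') + q * H ^ (i + i' + 1) := by
    dsimp only
    calc c * H ^ i * (c' * H ^ i') = (c * c') * H ^ (i + i') := by ring
      _ = _ := by rw [← hsum]; ring
  rw [hprod]
  refine Submodule.add_mem _ (mem_Filt hrd (h1.trans hcc)) (mem_Filt hqd ?_)
  have h3 := h2.trans hcc
  rw [vdeg_mul, hm] at h3
  by_cases hq0 : toRat f g hf q = 0
  · rw [vdeg_eq_bot.2 hq0]
    exact bot_le
  rw [vdeg_of_ne hq0] at h3 ⊢
  rw [← WithBot.coe_add, WithBot.coe_le_coe] at h3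
  refine WithBot.coe_le_coe.2 ?_
  push_cast at h3 ⊢
  linarith

theorem Regular.pow_mem_Filt (hreg : Regular f g hf G s) (hH : H.Monic)
    (hHd : H.natDegree = dimSeq f g hf G s) (hm : vdeg f g hf H = m)
    (hmd : ¬ (gcdSeq f g hf G s : ℤ) ∣ m) {P : LRing K}
    (hP : P ∈ Filt f g hf H (dimSeq f g hf G s) m b) (k : ℕ) :
    P ^ k ∈ Filt f g hf H (dimSeq f g hf G s) m (k * b) := by
  induction k with
  | zero =>
    have := pow_mem_Filt_self (f := f) (g := g) (hf := hf) (H := H) (m := m)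
      (dimSeq_pos (g := g) (hf := hf) (G := G) hreg.pos s) 0
    simpa using this
  | succ k ih =>
    rw [pow_succ]
    have := hreg.mul_mem_Filt hH hHd hm hmd ih hP
    rwa [show (k : ℤ) * b + b = (k + 1 : ℕ) * b by push_cast; ring] at this

/-- Sorts the generators c H^i by i > k, i = k and i < k. -/
theorem exists_expansion_of_mem_Filt (hH : H.Monic) (hHd : H.natDegree = D) (k : ℕ) {P : LRing K}
    (hP : P ∈ Filt f g hf H D m b) :
    ∃ w v R : LRing K, P = w * H ^ (k + 1) + v * H ^ k + R ∧ v.degree < D ∧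
      vdeg f g hf v ≤ ((b - k * m : ℤ) : WithBot ℤ) ∧ R.degree < (k * D : ℕ) := by
  induction hP using Submodule.span_induction with
  | zero => exact ⟨0, 0, 0, by simp, by simp, by simp [vdeg_zero],
      by rw [degree_zero]; exact WithBot.bot_lt_coe _⟩
  | add P P' _ _ h h' =>
    obtain ⟨w, v, R, rfl, hv, hv2, hR⟩ := h
    obtain ⟨w', v', R', rfl, hv', hv2', hR'⟩ := h'
    exact ⟨w + w', v + v', R + R', by ring, (degree_add_le _ _).trans_lt (max_lt hv hv'),
      (vdeg_add_le _ _).trans (max_le hv2 hv2'), (degree_add_le _ _).trans_lt (max_lt hR hR')⟩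
  | smul c P _ h =>
    obtain ⟨w, v, R, rfl, hv, hv2, hR⟩ := h
    exact ⟨c • w, c • v, c • R, by simp only [smul_add, smul_mul_assoc],
      (degree_smul_le _ _).trans_lt hv,
      (vdeg_smul_le _ _).trans hv2, (degree_smul_le _ _).trans_lt hR⟩
  | mem P hP =>
    obtain ⟨c, i, hc, hv, rfl⟩ := hP
    have hD0 : ∀ n : ℕ, (0 : LRing K).degree < (n : WithBot ℕ) := fun n => by
      rw [degree_zero]; exact WithBot.bot_lt_coe _
    rcases lt_trichotomy i k with h | rfl | h
    · exact ⟨0, 0, c * H ^ i, by ring, hD0 _, by rw [vdeg_zero]; exact bot_le,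
        degree_mul_pow_lt hH hHd hc h⟩
    · exact ⟨0, c, 0, by ring, hc, hv, hD0 _⟩
    · refine ⟨c * H ^ (i - (k + 1)), 0, 0, ?_, hD0 _, by rw [vdeg_zero]; exact bot_le, hD0 _⟩
      rw [mul_assoc, ← pow_add, Nat.sub_add_cancel h]
      ring

/-- The coefficient of `H ^ k` in the expansion of an element of degree less than
`(k + 1) deg H`. -/
theorem exists_expansion_of_degree_lt (hH : H.Monic) (hHd : H.natDegree = D) (k : ℕ) {P : LRing K}
    (hP : P ∈ Filt f g hf H D m b) (hPd : P.degree < ((k + 1) * D : ℕ)) :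
    ∃ v R : LRing K, P = v * H ^ k + R ∧ v.degree < D ∧
      vdeg f g hf v ≤ ((b - k * m : ℤ) : WithBot ℤ) ∧ R.degree < (k * D : ℕ) := by
  obtain ⟨w, v, R, h, hv, hv2, hR⟩ := exists_expansion_of_mem_Filt hH hHd k hP
  refine ⟨v, R, ?_, hv, hv2, hR⟩
  have hw : w = 0 := by
    by_contra hw
    have h1 : (w * H ^ (k + 1)).degree < ((k + 1) * D : ℕ) := by
      have : w * H ^ (k + 1) = P - v * H ^ k - R := by rw [h]; ring
      rw [this]
      refine (degree_sub_le _ _).trans_lt (max_lt ((degree_sub_le _ _).trans_lt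
        (max_lt hPd (degree_mul_pow_lt hH hHd hv (Nat.lt_succ_self k)))) (hR.trans_le ?_))
      exact Nat.cast_le.2 (Nat.mul_le_mul_right _ (Nat.le_succ k))
    rw [← natDegree_lt_iff_degree_lt (mul_ne_zero hw (hH.pow _).ne_zero),
      natDegree_mul hw (hH.pow _).ne_zero, hH.natDegree_pow, hHd] at h1
    omega
  rw [h, hw, zero_mul, zero_add]

/-- One step of the algorithm, seen in the filtration attached to `H`. -/
theorem Regular.step_mem_Filt {t E : ℕ} (hreg : Regular f g hf G (t + 1)) (hst : s ≤ t)
    (hs : IsStep f g hf G t) (hH : H.Monic)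
    (hHd : H.natDegree = dimSeq f g hf G s) (hm : vdeg f g hf H = m)
    (hmd : ¬ (gcdSeq f g hf G s : ℤ) ∣ m)
    (hG : G t ∈ Filt f g hf H (dimSeq f g hf G s) m (E * m))
    (hle : zdeg f g hf (G t) ≤ E * m)
    (hM : ∀ M ∈ Std Set.univ G (ratioSeq f g hf G) t, ∀ N : ℤ, vdeg f g hf M = N →
      M ∈ Filt f g hf H (dimSeq f g hf G s) m (N + (E * m - zdeg f g hf (G t)))) :
    G (t + 1) ∈ Filt f g hf H (dimSeq f g hf G s) m ((ratioSeq f g hf G t * E : ℕ) * m) ∧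
    ∀ M ∈ Std Set.univ G (ratioSeq f g hf G) (t + 1), ∀ N : ℤ, vdeg f g hf M = N →
      M ∈ Filt f g hf H (dimSeq f g hf G s) m
        (N + ratioSeq f g hf G t * (E * m - zdeg f g hf (G t))) := by
  have hregs := hreg.mono (show s ≤ t + 1 by omega)
  have h0 := hreg.ne_zero t (by omega)
  have key : ∀ M ∈ Std Set.univ G (ratioSeq f g hf G) (t + 1), ∀ N : ℤ, vdeg f g hf M = N →
      M ∈ Filt f g hf H (dimSeq f g hf G s) m
        (N + ratioSeq f g hf G t * (E * m - zdeg f g hf (G t))) := by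
    rintro _ ⟨M, hMs, j, hj, rfl⟩ N hN
    obtain ⟨N', hN', -⟩ := vdeg_Std t (hreg.mono (Nat.le_succ t)).ne_zero M hMs
    rw [vdeg_mul, hN', vdeg_pow (vdeg_of_ne h0), ← WithBot.coe_add, WithBot.coe_inj] at hN
    refine Filt_mono ?_ (hregs.mul_mem_Filt hH hHd hm hmd (hM M hMs N' hN')
      (hregs.pow_mem_Filt hH hHd hm hmd hG j))
    -- The excess E m - deg g_t occurs once for `M` and j times for the power of g_t, in all at most
    -- a_t times.
    have hj' : (j : ℤ) + 1 ≤ ratioSeq f g hf G t := by exact_mod_cast hj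
    nlinarith [mul_le_mul_of_nonneg_right hj' (sub_nonneg.2 hle)]
  refine ⟨?_, key⟩
  rw [← sub_sub_cancel (G t ^ ratioSeq f g hf G t) (G (t + 1))]
  refine Submodule.sub_mem _ (Filt_mono (le_of_eq ?_)
    (hregs.pow_mem_Filt hH hHd hm hmd hG (ratioSeq f g hf G t))) ?_
  · push_cast
    ring
  · refine Submodule.span_le.2 ?_ (step_spec hreg.pos hreg.ne_zero hs).2
    rintro M ⟨hMs, hle, -⟩
    obtain ⟨N, hN, -⟩ := vdeg_Std (t + 1) hreg.ne_zero M hMs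
    rw [hN, WithBot.coe_le_coe] at hle
    refine Filt_mono ?_ (key M hMs N hN)
    push_cast
    linarith

/-- The elements `g_t` of a run in the filtration attached to a polynomial `H` which differs from
`g_s` by an element of smaller degree. -/
theorem IsRun.mem_Filt {r : ℕ} (hn : 0 < f.natDegree) (hrun : IsRun f g hf G r) (hs : s < r)
    (hmd : ¬ (gcdSeq f g hf G s : ℤ) ∣ zdeg f g hf (G s)) (hH : H.Monic)
    (hHd : H.natDegree = dimSeq f g hf G s)
    (hHs : vdeg f g hf (G s - H) < (zdeg f g hf (G s) : ℤ)) :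
    ∃ E : ℕ, dimSeq f g hf G r = E * dimSeq f g hf G s ∧
      G r ∈ Filt f g hf H (dimSeq f g hf G s) (zdeg f g hf (G s)) (E * zdeg f g hf (G s)) := by
  obtain ⟨hreg, -, -⟩ := hrun.regular hn
  have hsne := hreg.ne_zero s hs
  set m := zdeg f g hf (G s) with hmdef
  have hm : vdeg f g hf H = m := by
    rw [← vdeg_of_ne hsne] at hHs
    rw [← sub_sub_cancel (G s) H, vdeg_sub_eq_left hHs, vdeg_of_ne hsne]
  -- Weight may exceed z-degree, by E m - deg g_t. As deg g_{t+1} < a_t deg g_t, the new excess is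
  -- at least a_t times the old one, which keeps the bound for monomials inductive.
  have main : ∀ t, s ≤ t → t < r → ∃ E : ℕ, dimSeq f g hf G t = E * dimSeq f g hf G s ∧
      G t ∈ Filt f g hf H (dimSeq f g hf G s) m (E * m) ∧ zdeg f g hf (G t) ≤ E * m ∧
      ∀ M ∈ Std Set.univ G (ratioSeq f g hf G) t, ∀ N : ℤ, vdeg f g hf M = N →
        M ∈ Filt f g hf H (dimSeq f g hf G s) m (N + (E * m - zdeg f g hf (G t))) := by
    intro t hst
    induction t, hst using Nat.le_induction with
    | base =>
      intro _
      refine ⟨1, by rw [one_mul], ?_, by rw [Nat.cast_one, one_mul], fun M hM N hN => ?_⟩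
      · rw [← sub_add_cancel (G s) H]
        refine Submodule.add_mem _ (mem_Filt_of_degree_lt (degree_sub_lt_of_monic
          (hreg.monic s hs) (hreg.natDegree s hs) hH hHd) ?_) ?_
        · rw [Nat.cast_one, one_mul]
          exact hHs.le
        · have := pow_mem_Filt_self (f := f) (g := g) (hf := hf) (H := H) (m := m)
            (dimSeq_pos (g := g) (hf := hf) (G := G) hn s) 1
          rwa [pow_one] at this
      · refine mem_Filt_of_degree_lt ((hreg.mono hs.le).degree_lt (Submodule.subset_span hM)) ?_
        rw [hN, ← hmdef, Nat.cast_one, one_mul, sub_self, add_zero]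
    | succ t hst ih =>
      intro ht
      obtain ⟨E, hE, hG, hle, hM⟩ := ih (by omega)
      have hstep := (hrun.2 t (by omega)).2
      obtain ⟨h1, h2⟩ := (hreg.mono (show t + 1 ≤ r by omega)).step_mem_Filt hst hstep
        hH hHd hm hmd hG hle hM
      have hlt := (step_spec hn (hreg.mono (show t + 1 ≤ r by omega)).ne_zero hstep).1
      rw [vdeg_of_ne (hreg.ne_zero (t + 1) ht), WithBot.coe_lt_coe] at hlt
      have ha : (0 : ℤ) ≤ ratioSeq f g hf G t := Int.natCast_nonneg _
      have hmul := mul_le_mul_of_nonneg_left hle ha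
      refine ⟨ratioSeq f g hf G t * E, by rw [dimSeq_succ, hE, mul_assoc], h1, ?_,
        fun M hM N hN => Filt_mono ?_ (h2 M hM N hN)⟩
      · push_cast
        linarith
      · push_cast
        linarith
  obtain ⟨r, rfl⟩ := Nat.exists_eq_succ_of_ne_zero (show r ≠ 0 by omega)
  obtain ⟨E, hE, hG, hle, hM⟩ := main r (by omega) (by omega)
  exact ⟨ratioSeq f g hf G r * E, by rw [Nat.succ_eq_add_one, dimSeq_succ, hE, mul_assoc],
    (hreg.step_mem_Filt (by omega) (hrun.2 r (by omega)).2 hH hHd hm hmd hG hle hM).1⟩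

/-- An approximate root of the last element of a run which differs from `g_s` by an element of
smaller degree. -/
theorem IsRun.exists_approximateRoot {r e : ℕ} (hn : 0 < f.natDegree) (hrun : IsRun f g hf G r)
    (hs : s < r) (hmd : ¬ (gcdSeq f g hf G s : ℤ) ∣ zdeg f g hf (G s))
    (hE : dimSeq f g hf G r = e * dimSeq f g hf G s) (he : (e : K) ≠ 0) :
    ∃ H : LRing K, H.Monic ∧ H.natDegree = dimSeq f g hf G s ∧
      vdeg f g hf (G s - H) < (zdeg f g hf (G s) : ℤ) ∧
      ∀ l, (e - 1) * dimSeq f g hf G s ≤ l → (G r - H ^ e).coeff l = 0 := by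
  obtain ⟨hreg, hrm, hrd⟩ := hrun.regular hn
  have hregs := hreg.mono hs.le
  have he0 : 0 < e := Nat.pos_of_ne_zero (by rintro rfl; simp at he)
  set D := dimSeq f g hf G s with hD
  have hD0 : 0 < D := dimSeq_pos hn s
  have heD : (e - 1) * D + D = e * D := by
    rw [← Nat.succ_mul, Nat.succ_eq_add_one, Nat.sub_add_cancel he0]
  -- Starting from g_s, each round kills one further coefficient of g_r - H^e, from the top down to
  -- (e-1)D.
  have main : ∀ k, ∃ H : LRing K, H.Monic ∧ H.natDegree = D ∧
      vdeg f g hf (G s - H) < (zdeg f g hf (G s) : ℤ) ∧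
      ∀ l, (e - 1) * D + (D - k) ≤ l → (G r - H ^ e).coeff l = 0 := by
    intro k
    induction k with
    | zero =>
      have hm := hreg.monic s hs
      have hd := hreg.natDegree s hs
      refine ⟨G s, hm, hd, by rw [sub_self, vdeg_zero]; exact WithBot.bot_lt_coe _,
        fun l hl => ?_⟩
      rw [Nat.sub_zero, heD] at hl
      exact (degree_lt_iff_coeff_zero _ _).1 (degree_sub_lt_of_monic hrm (hrd.trans hE)
        (hm.pow e) (by rw [hm.natDegree_pow, hd])) l hl
    | succ k ih =>
      obtain ⟨H, hH, hHd, hHs, hco⟩ := ih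
      by_cases hk : D - k = 0
      · exact ⟨H, hH, hHd, hHs, fun l hl => hco l (by omega)⟩
      obtain ⟨E, hE', hmem⟩ := hrun.mem_Filt hn hs hmd hH hHd hHs
      have hEe : E = e := Nat.eq_of_mul_eq_mul_right hD0 (hE'.symm.trans hE)
      subst hEe
      have hmem' := Submodule.sub_mem _ hmem (pow_mem_Filt_self (f := f) (g := g) (hf := hf)
        (H := H) (m := zdeg f g hf (G s)) hD0 E)
      have hdeg : (G r - H ^ E).degree < ((E - 1 + 1) * D : ℕ) := by
        rw [Nat.sub_add_cancel he0]
        exact degree_sub_lt_of_monic hrm (hrd.trans hE) (hH.pow E) (by rw [hH.natDegree_pow, hHd])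
      obtain ⟨v, R, hvR, hvd, hvv, hRd⟩ := exists_expansion_of_degree_lt hH hHd (E - 1) hmem' hdeg
      have hpd : (H ^ (E - 1)).natDegree = (E - 1) * D := by rw [hH.natDegree_pow, hHd]
      have hcoeff : ∀ j, v.natDegree ≤ j → (G r - H ^ E).coeff ((E - 1) * D + j) = v.coeff j := by
        intro j hj
        rw [hvR, coeff_add, (degree_lt_iff_coeff_zero _ _).1 hRd _ (by omega), add_zero, mul_comm v,
          coeff_mul_add_eq_of_natDegree_le hpd.le hj, ← hpd, (hH.pow _).coeff_natDegree, one_mul]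
      have hvj : v.natDegree ≤ D - (k + 1) := by
        by_contra hlt
        have h1 := hcoeff v.natDegree le_rfl
        rw [hco _ (by omega)] at h1
        have hv0 : v = 0 := leadingCoeff_eq_zero.1 h1.symm
        rw [hv0, natDegree_zero] at hlt
        omega
      -- The filtration gives the bound e m_s - (e-1) m_s = m_s; equality is excluded because
      -- d_{s-1} divides the degree of v but not m_s.
      have hvlt : vdeg f g hf v < (zdeg f g hf (G s) : ℤ) := by
        by_cases hv0 : v = 0
        · rw [hv0, vdeg_zero]
          exact WithBot.bot_lt_coe _
        obtain ⟨N, hN, hdN⟩ := hregs.exists_vdeg hvd hv0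
        rw [hN, WithBot.coe_le_coe, Nat.cast_sub he0] at hvv
        rw [hN, WithBot.coe_lt_coe]
        refine lt_of_le_of_ne (by push_cast at hvv; linarith) ?_
        rintro rfl
        exact hmd hdN
      -- Replacing H by H + u adds e times the coefficient of u at the position to be killed, which
      -- is the coefficient of v.
      set u : LRing K := (E : K)⁻¹ • v with hu
      have hud : (-u).degree < D := by
        rw [degree_neg]
        exact (degree_smul_le _ _).trans_lt hvd
      have hH' := monic_sub hH hHd hud
      rw [sub_neg_eq_add] at hH'
      have huj : (H + u - H).natDegree ≤ D - (k + 1) := by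
        rw [add_sub_cancel_left]
        exact (natDegree_smul_le _ _).trans hvj
      obtain ⟨hp1, hp2⟩ := coeff_pow_sub_pow (e := E) hH'.1 hH'.2 hH hHd huj
      refine ⟨H + u, hH'.1, hH'.2, ?_, fun l hl => ?_⟩
      · rw [← sub_sub]
        exact (vdeg_sub_le _ _).trans_lt (max_lt hHs ((vdeg_smul_le _ _).trans_lt hvlt))
      · have hsplit : G r - (H + u) ^ E = (G r - H ^ E) - ((H + u) ^ E - H ^ E) := by ring
        rw [hsplit, coeff_sub]
        rcases eq_or_lt_of_le hl with rfl | hl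
        · rw [hp2, hcoeff _ hvj, add_sub_cancel_left, hu, coeff_smul]
          have : ((E : ℕ) : LaurentPolynomial K) * ((E : K)⁻¹ • v.coeff (D - (k + 1))) =
              v.coeff (D - (k + 1)) := by
            rw [← nsmul_eq_mul, ← Nat.cast_smul_eq_nsmul K, smul_smul, mul_inv_cancel₀ he, one_smul]
          rw [this, sub_self]
        · rw [hco l (by omega), coeff_eq_zero_of_natDegree_lt (hp1.trans_lt hl), sub_zero]
  obtain ⟨H, h1, h2, h3, h4⟩ := main D
  exact ⟨H, h1, h2, h3, fun l hl => h4 l (by omega)⟩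

/-! ### Descent of polynomiality from the last element -/

/-- The terms of high degree of a combination of monomials `S' ⊆ S`. -/
theorem mem_span_of_add_mem_span {S S' : Set (LRing K)} (hS : ∀ M ∈ S, toRat f g hf M ≠ 0)
    (hinj : Set.InjOn (vdeg f g hf) S) (hSS : S' ⊆ S) {P u : LRing K} {b : WithBot ℤ}
    (hP : P ∈ Submodule.span K {M ∈ S | b < vdeg f g hf M}) (hu : vdeg f g hf u ≤ b)
    (hPu : P + u ∈ Submodule.span K S') : P ∈ Submodule.span K S' := by
  have hsub : S' ⊆ {M ∈ S' | b < vdeg f g hf M} ∪ {M ∈ S' | vdeg f g hf M ≤ b} := by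
    intro M hM
    rcases lt_or_ge b (vdeg f g hf M) with h | h
    exacts [Or.inl ⟨hM, h⟩, Or.inr ⟨hM, h⟩]
  have h1 := Submodule.span_mono hsub hPu
  rw [Submodule.span_union] at h1
  obtain ⟨Y, hY, Z, hZ, hYZ⟩ := Submodule.mem_sup.1 h1
  have hZb : vdeg f g hf Z ≤ b := vdeg_le_of_mem_span (fun M hM => hM.2) hZ
  have hPY : P - Y ∈ Submodule.span K {M ∈ S | b < vdeg f g hf M} :=
    Submodule.sub_mem _ hP (Submodule.span_mono (fun M hM => Set.mem_sep (hSS hM.1) hM.2) hY)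
  -- P - Y only involves monomials of degree above b, yet its own degree is at most b; hence it has
  -- no leading term.
  have hPYb : vdeg f g hf (P - Y) ≤ b := by
    rw [show P - Y = Z - u by linear_combination -hYZ]
    exact (vdeg_sub_le _ _).trans (max_le hZb hu)
  have : P - Y = 0 := by
    by_contra hne
    obtain ⟨M, hM, c, -, hv, -⟩ := exists_leading_term (fun M hM => hS M hM.1)
      (hinj.mono fun M hM => hM.1) hPY hne
    exact absurd (hM.2.trans_le (hv ▸ hPYb)) (lt_irrefl _)
  rw [sub_eq_zero.1 this]
  exact Submodule.span_mono (fun M hM => hM.1) hY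

theorem zdeg_varG : zdeg f g hf (varG K) = g.natDegree := by
  rw [zdeg, toRat_varG, RatFunc.intDegree_polynomial]

theorem IsRun.gcdSeq_one {r : ℕ} (hrun : IsRun f g hf G r) :
    gcdSeq f g hf G 1 = Nat.gcd f.natDegree g.natDegree := by
  rw [gcdSeq, gcdSeq, hrun.1, zdeg_varG, Int.natAbs_natCast]

/-- All elements of a complete run are polynomials in `f` and `g`. -/
theorem IsRun.coeffIn (p : ℕ) [CharP K p] (hpd : ¬ p ∣ Nat.gcd f.natDegree g.natDegree)
    (hn : 0 < f.natDegree) {r : ℕ} (hrun : IsRun f g hf G r) (h0 : toRat f g hf (G r) = 0) :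
    ∀ s ≤ r, CoeffIn (polyPart K) (G s) := by
  obtain ⟨hreg, hrm, hrd⟩ := hrun.regular hn
  intro s
  induction s using Nat.strong_induction_on with
  | _ s ih =>
    intro hsr
    rcases eq_or_lt_of_le hsr with rfl | hs
    · exact hrun.coeffIn_last hn h0
    rcases Nat.eq_zero_or_pos s with rfl | hs0
    · rw [hrun.1]
      exact coeffIn_X
    have hregs := hreg.mono hs.le
    have hmd := (hrun.mono hs.le).not_dvd hs0 (hreg.ne_zero s hs)
    have hmul : ∃ e, dimSeq f g hf G r = e * dimSeq f g hf G s := by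
      rw [dimSeq, dimSeq, ← Finset.prod_range_mul_prod_Ico _ hsr]
      exact ⟨_, mul_comm _ _⟩
    obtain ⟨e, he⟩ := hmul
    -- Thus e divides d_{s-1}, which divides d_0 = gcd(n, m) because s > 0; so p does not divide e.
    have hegcd : e * gcdSeq f g hf G r = gcdSeq f g hf G s := by
      have h1 := dimSeq_mul_gcdSeq (f := f) (g := g) (hf := hf) (G := G) r
      rw [← dimSeq_mul_gcdSeq (f := f) (g := g) (hf := hf) (G := G) s, he] at h1
      refine Nat.eq_of_mul_eq_mul_left (dimSeq_pos (g := g) (hf := hf) (G := G) hn s) ?_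
      rw [← h1]
      ring
    have heK : (e : K) ≠ 0 := by
      rw [Ne, CharP.cast_eq_zero_iff K p]
      intro hpe
      refine hpd ?_
      rw [← hrun.gcdSeq_one]
      exact hpe.trans ((Dvd.intro _ hegcd).trans (gcdSeq_dvd hs0))
    obtain ⟨H, hH, hHd, hHs, hco⟩ := hrun.exists_approximateRoot hn hs hmd he heK
    have hHc : CoeffIn (polyPart K) H := by
      refine approximateRoot_coeff_mem (polyPart K).toSubring hH hHd
        (hrun.coeffIn_last hn h0) hco fun x hx => ?_
      have : x = (e : K)⁻¹ • ((e : LaurentPolynomial K) * x) := by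
        rw [← nsmul_eq_mul, ← Nat.cast_smul_eq_nsmul K, smul_smul, inv_mul_cancel₀ heK, one_smul]
      rw [this]
      exact (polyPart K).smul_mem hx _
    obtain ⟨s, rfl⟩ := Nat.exists_eq_succ_of_ne_zero hs0.ne'
    have hGs := ih s (by omega) (by omega)
    have hpow := hGs.pow (ratioSeq f g hf G s)
    obtain ⟨-, hX⟩ := step_spec hn hregs.ne_zero (hrun.2 s (by omega)).2
    have hY : G s ^ ratioSeq f g hf G s - H ∈
        Submodule.span K (Std {i | 0 ≤ i} G (ratioSeq f g hf G) (s + 1)) := by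
      refine hregs.mem_span_nonneg (fun k hk => ih k hk (by omega)) (hpow.sub hHc) ?_
      refine degree_sub_lt_of_monic ((hreg.monic s (by omega)).pow _) ?_ hH hHd
      rw [(hreg.monic s (by omega)).natDegree_pow, hreg.natDegree s (by omega), ← dimSeq_succ]
    -- The cut is made at the degree of `G (s + 1)`: the monomials subtracted by the algorithm lie
    -- above it, the correction `G (s + 1) - H` below it.
    have hX' := mem_span_of_add_mem_span (Std_toRat_ne_zero (s + 1) hregs.ne_zero)
      (Std_injOn hn (s + 1) hregs.ne_zero) (Std_mono (Set.subset_univ {i | 0 ≤ i}) (s + 1))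
      (b := vdeg f g hf (G (s + 1))) (u := G (s + 1) - H)
      (Submodule.span_mono (fun M hM => Set.mem_sep hM.1 hM.2.2) hX)
      (by rw [vdeg_of_ne (hreg.ne_zero (s + 1) hs)]; exact hHs.le)
      (by rwa [sub_add_sub_cancel])
    have := hpow.sub (coeffIn_of_mem_span (Std_coeffIn (fun i hi => T_mem_polyPart.2 hi) (s + 1)
      fun k hk => ih k hk (by omega)) hX')
    rwa [sub_sub_cancel] at this

end Filtration

/-! ### The degrees in K[f, g] and the divisibility conclusion -/

section Main

variable {K : Type*} [Field K] {f g : K[X]} {hf : f ≠ 0}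

theorem mem_adjoin_of_coeffIn {P : LRing K} (hP : CoeffIn (polyPart K) P) :
    P ∈ Algebra.adjoin K {varF K, varG K} := by
  have hF : varF K ∈ Algebra.adjoin K {varF K, varG K} := Algebra.subset_adjoin (by simp)
  have hG : X ∈ Algebra.adjoin K {varF K, varG K} := Algebra.subset_adjoin (by simp [varG])
  rw [P.as_sum_range_C_mul_X_pow]
  refine Subalgebra.sum_mem _ fun k _ => Subalgebra.mul_mem _ ?_ (Subalgebra.pow_mem _ hG k)
  have hspan := C_mem_span_of_mem_polyPart (G := fun _ => 0) (a := fun _ => 0) (hP k)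
  refine (Submodule.span_le (p := Subalgebra.toSubmodule
    (Algebra.adjoin K {varF K, varG K}))).2 ?_ hspan
  rintro _ ⟨i, hi, rfl⟩
  have : (C (LaurentPolynomial.T i) : LRing K) = varF K ^ i.toNat := by
    rw [varF, ← C_pow, LaurentPolynomial.T_pow, mul_one, Int.toNat_of_nonneg hi]
  rw [this]
  exact Subalgebra.pow_mem _ hF _

theorem exists_coeffIn_of_mem_adjoin {q : K[X]} (hq : q ∈ Algebra.adjoin K {f, g}) :
    ∃ P : LRing K, CoeffIn (polyPart K) P ∧
      toRat f g hf P = algebraMap K[X] (RatFunc K) q := by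
  induction hq using Algebra.adjoin_induction with
  | mem x hx =>
    rcases hx with rfl | rfl
    · exact ⟨C (LaurentPolynomial.T 1), coeffIn_C (T_mem_polyPart.2 zero_le_one), by
        rw [toRat_T, zpow_one]⟩
    · exact ⟨X, coeffIn_X, toRat_X⟩
  | algebraMap c =>
    refine ⟨C (LaurentPolynomial.C c), coeffIn_C ((polyPart K).algebraMap_mem c), ?_⟩
    rw [toRat_C_C]
    exact (RatFunc.algebraMap_C c).symm
  | add x y _ _ hx hy =>
    obtain ⟨P, hP, hP'⟩ := hx
    obtain ⟨Q, hQ, hQ'⟩ := hy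
    exact ⟨P + Q, hP.add hQ, by rw [map_add, map_add, hP', hQ']⟩
  | mul x y _ _ hx hy =>
    obtain ⟨P, hP, hP'⟩ := hx
    obtain ⟨Q, hQ, hQ'⟩ := hy
    exact ⟨P * Q, hP.mul hQ, by rw [map_mul, map_mul, hP', hQ']⟩

/-- Non-zero elements of `K[f(z), g(z)]` have the degrees of standard monomials with non-negative
exponents. -/
theorem IsRun.exists_Std_of_mem_adjoin {G : ℕ → LRing K} {r : ℕ} (hn : 0 < f.natDegree)
    (hrun : IsRun f g hf G r) (h0 : toRat f g hf (G r) = 0)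
    (hG : ∀ s ≤ r, CoeffIn (polyPart K) (G s)) {q : K[X]} (hq : q ∈ Algebra.adjoin K {f, g})
    (hq0 : q ≠ 0) :
    ∃ M ∈ Std {i | 0 ≤ i} G (ratioSeq f g hf G) r, vdeg f g hf M = (q.natDegree : ℤ) := by
  obtain ⟨hreg, hrm, hrd⟩ := hrun.regular hn
  obtain ⟨P, hP, hPq⟩ := exists_coeffIn_of_mem_adjoin (hf := hf) hq
  -- `G r` vanishes in K(z), so reduction modulo it keeps the image while making the g-degree less
  -- than D_r.
  set R := P %ₘ G r with hR
  have hRq : toRat f g hf R = algebraMap K[X] (RatFunc K) q := by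
    rw [← hPq, ← modByMonic_add_div P (G r), map_add, map_mul, h0, zero_mul, add_zero]
  have hR0 : toRat f g hf R ≠ 0 := by
    rw [hRq]
    exact RatFunc.algebraMap_ne_zero hq0
  have hRd : R.degree < dimSeq f g hf G r := by
    rw [← hrd, ← degree_eq_natDegree hrm.ne_zero]
    exact degree_modByMonic_lt _ hrm
  have hmem := hreg.mem_span_nonneg (fun k hk => hG k hk.le) (hP.mod_div (hG r le_rfl) hrm).1 hRd
  obtain ⟨M, hM, c, -, hv, -⟩ := exists_leading_term (Std_toRat_ne_zero r hreg.ne_zero)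
    (Std_injOn hn r hreg.ne_zero) hmem (by
      rintro h
      rw [hR, h, map_zero] at hR0
      exact hR0 rfl)
  refine ⟨M, hM, ?_⟩
  rw [← hv, vdeg_of_ne hR0, zdeg, hRq, RatFunc.intDegree_polynomial]

theorem dvd_or_dvd_of_adjoin_eq_top (p : ℕ) [CharP K p]
    (hpd : ¬ p ∣ Nat.gcd f.natDegree g.natDegree)
    (h : Algebra.adjoin K {f, g} = (⊤ : Subalgebra K K[X])) :
    f.natDegree ∣ g.natDegree ∨ g.natDegree ∣ f.natDegree := by
  rcases Nat.eq_zero_or_pos f.natDegree with hn | hn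
  · right
    rw [hn]
    exact dvd_zero _
  rcases Nat.eq_zero_or_pos g.natDegree with hm | hm
  · left
    rw [hm]
    exact dvd_zero _
  have hf : f ≠ 0 := by rintro rfl; simp at hn
  have hrun0 : IsRun f g hf (fun _ => varG K) 0 := ⟨rfl, fun i hi => by omega⟩
  obtain ⟨r, G, -, -, hrun, h0⟩ := hrun0.exists_complete hn
  obtain ⟨hreg, -, -⟩ := hrun.regular hn
  have hG := hrun.coeffIn p hpd hn h0
  have hr : 1 ≤ r := by
    by_contra hr
    have : r = 0 := by omega
    subst this
    rw [hrun.1, toRat_varG] at h0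
    have hg : g ≠ 0 := by rintro rfl; simp at hm
    exact RatFunc.algebraMap_ne_zero hg h0
  set d := Nat.gcd f.natDegree g.natDegree with hd
  have hd0 : 0 < d := Nat.gcd_pos_of_pos_left _ hn
  obtain ⟨M, hM, hMd⟩ := hrun.exists_Std_of_mem_adjoin hn h0 hG
    (q := X ^ d) (by rw [h]; trivial) (pow_ne_zero _ X_ne_zero)
  rw [natDegree_X_pow] at hMd
  -- Since d = d_0, some f^i g^j with i ∈ ℤ already has degree d; uniqueness of degrees identifies
  -- it with the polynomial monomial `M`, so i ≥ 0.
  obtain ⟨M', hM', hMd'⟩ := exists_Std_vdeg_eq hn 1 (fun k hk => hreg.ne_zero k (by omega)) d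
    (by rw [hrun.gcdSeq_one])
  have hMM : M = M' := Std_injOn hn r hreg.ne_zero (Std_mono (Set.subset_univ _) r hM)
    (Std_subset_of_le hr (fun k _ => ratioSeq_pos hn k) hM') (hMd.trans hMd'.symm)
  have hc : CoeffIn (polyPart K) M := Std_coeffIn (fun i hi => T_mem_polyPart.2 hi) r
    (fun k hk => hG k hk.le) M hM
  obtain ⟨_, ⟨i, -, rfl⟩, j, -, rfl⟩ := hM'
  rw [hMM, hrun.1] at hc
  have hi : 0 ≤ i := by
    have := hc j
    rw [varG, coeff_C_mul, coeff_X_pow_self, mul_one] at this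
    exact T_mem_polyPart.1 this
  have hg0 : toRat f g hf (G 0) ≠ 0 := hreg.ne_zero 0 (by omega)
  have hdeg : i * f.natDegree + j * g.natDegree = (d : ℤ) := by
    rw [vdeg_mul, vdeg_T, vdeg_pow (vdeg_of_ne hg0), hrun.1, zdeg_varG, ← WithBot.coe_add,
      WithBot.coe_inj] at hMd'
    exact hMd'
  obtain ⟨i, rfl⟩ := Int.eq_ofNat_of_zero_le hi
  have hdeg' : i * f.natDegree + j * g.natDegree = d := by exact_mod_cast hdeg
  rcases Nat.eq_zero_or_pos i with rfl | hi'
  · right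
    rw [zero_mul, zero_add] at hdeg'
    exact (Dvd.intro_left _ hdeg').trans (Nat.gcd_dvd_left _ _)
  · left
    have h1 : f.natDegree ≤ d := by nlinarith
    have h2 : d = f.natDegree :=
      le_antisymm (Nat.le_of_dvd hn (Nat.gcd_dvd_left _ _)) h1
    rw [← h2]
    exact Nat.gcd_dvd_right _ _

end Main

end AMS

theorem mainTheorem6 {K : Type*} [Field K] (p : ℕ) (hp : p.Prime) [CharP K p]
    (f g : Polynomial K) (hpd : ¬ p ∣ Nat.gcd f.natDegree g.natDegree) :
    (∀ hf : f ≠ 0, 0 < f.natDegree →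
      (∃ (s : ℕ) (G : ℕ → AMS.LRing K),
        AMS.IsRun f g hf G s ∧ AMS.toRat f g hf (G s) = 0) ∧
      (∀ (s : ℕ) (G : ℕ → AMS.LRing K), AMS.IsRun f g hf G s →
        ∀ i ≤ s, G i ∈ Algebra.adjoin K {AMS.varF K, AMS.varG K})) ∧
    (Algebra.adjoin K {f, g} = (⊤ : Subalgebra K (Polynomial K)) →
      f.natDegree ∣ g.natDegree ∨ g.natDegree ∣ f.natDegree) := by
  refine ⟨fun hf hn => ⟨?_, fun s G hrun i hi => ?_⟩, AMS.dvd_or_dvd_of_adjoin_eq_top p hpd⟩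
  · have hrun0 : AMS.IsRun f g hf (fun _ => AMS.varG K) 0 := ⟨rfl, fun i hi => by omega⟩
    obtain ⟨r, G, -, -, hrun, h0⟩ := hrun0.exists_complete hn
    exact ⟨r, G, hrun, h0⟩
  -- Polynomiality is derived backwards from the last element, so a partial run is first completed.
  · obtain ⟨r, G', hsr, hG', hrun', h0⟩ := hrun.exists_complete hn
    rw [← hG' i hi]
    exact AMS.mem_adjoin_of_coeffIn (hrun'.coeffIn p hpd hn h0 i (hi.trans hsr))
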